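/- **Setting.** Let $n>1$, let $A=\mathbb C\{x_1,\dots,x_n\}$ be the ring of convergent power series, $\partial_k=\partial/\partial x_k$, and let $w=(w_1,\dots,w_n)$ be rational numbers with $0<w_k\le 1/2$. Let $f\in A$ be semiquasihomogeneous of weight $w$, i.e. $f=f'+f''$, where $f'$ is a polynomial that is a linear combination of monomials $x^\nu$ with $\sum_k w_k\nu_k=1$ and has an isolated singularity at $0$ (the origin is an isolated common zero of $\partial_1f',\dots,\partial_nf'$), and $f''\in A$ contains only monomials $x^\nu$ with $\sum_k w_k\nu_k>1$. Let $A[\partial_t,\partial_t^{-1}]=A\otimes_{\mathbb C}\mathbb C[\partial_t,\partial_t^{-1}]$ with the commuting operators $\partial_k(a\otimes\partial_t^i)=\partial_k a\otimes\partial_t^i-(\partial_kf)a\otimes\partial_t^{i+1}$. The (algebraic) microlocal Gauss–Manin complex $K_f$ is the Koszul complex of $\partial_1,\dots,\partial_n$ on $A[\partial_t,\partial_t^{-1}]$ shifted by $n$: for $j\in\mathbb Z$, $K_f^{j-n}=\bigoplus_{|I|=j}A[\partial_t,\partial_t^{-1}]\otimes dx_I$ (sum over $I\subseteq\{1,\dots,n\}$),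 with differential $\omega\otimes dx_J\mapsto\sum_k\partial_k\omega\otimes dx_k\wedge dx_J$. For $\alpha\in\mathbb Q$ let $U^\alpha A$ be the set of $a\in A$ all of whose monomials $x^\nu$ satisfy $\sum_k w_k(\nu_k+1)\ge\alpha$. For $p\in\mathbb Z$ and $\alpha\in\mathbb Q$ put $$F_p(A[\partial_t,\partial_t^{-1}])=\bigoplus_{i\le p}A\otimes\partial_t^i,\qquad U^\alpha(A[\partial_t,\partial_t^{-1}])=\bigoplus_{i\in\mathbb Z}U^{\alpha+i}A\otimes\partial_t^i .$$ The subcomplexes $F_pK_f$ and $U^\alpha K_f$ of $K_f$ are the direct sums over $I$ of $F_{p+|I|-n}(A[\partial_t,\partial_t^{-1}])\otimes dx_I$ and of $U^{\alpha+w'(I)}(A[\partial_t,\partial_t^{-1}])\otimes dx_I$ respectively, where $w'(I)=\sum_{k=1}^n w_k-\sum_{k\in I}w_k$. **Strictness.** For subcomplexes $S,T$ of a complex $K$ there is a $3\times3$ diagram with short exact rows and columns $$\begin{array}{ccccc}S\cap T&\to&S&\to&S/(S\cap T)\\ \downarrow&&\downarrow&&\downarrow\\ T&\to&K&\to&K/T\\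 \downarrow&&\downarrow&&\downarrow\\ T/(S\cap T)&\to&K/S&\to&K/(S+T).\end{array}$$ One calls $(K;S,T)$ strict if, for every $j\in\mathbb Z$, all rows and columns remain short exact (with zeros at both ends) after applying $H^j$. A bifiltered complex $(K;F,U)$ is strict if $(K;F_pK,U^\alpha K)$ is strict for all $p$ and $\alpha$. **Proposition 5.2.** The bifiltered complex $(K_f;F,U)$ is strict. -/

import Mathlib

open CategoryTheory

/-! ## Strict bifiltered complexes -/

namespace Bifiltered

universe u v

variable {R : Type u} [Ring R]

/-- A subcomplex of a complex of `R`-modules: submodules stable under the differential. -/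
@[ext]
structure Subcomplex (K : CochainComplex (ModuleCat.{v} R) ℤ) where
  carrier : ∀ j : ℤ, Submodule R (K.X j)
  d_mem : ∀ (i j : ℤ) (x : K.X i), x ∈ carrier i → (K.d i j).hom x ∈ carrier j

namespace Subcomplex

variable {K : CochainComplex (ModuleCat.{v} R) ℤ}

instance : PartialOrder (Subcomplex K) :=
  PartialOrder.lift Subcomplex.carrier fun _ _ h => Subcomplex.ext h

/-- The lattice of subcomplexes; intersections and sums are formed degree by degree. -/
instance : Lattice (Subcomplex K) where
  inf S T :=
    { carrier := fun j => S.carrier j ⊓ T.carrier j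
      d_mem := fun i j x hx => ⟨S.d_mem i j x hx.1, T.d_mem i j x hx.2⟩ }
  sup S T :=
    { carrier := fun j => S.carrier j ⊔ T.carrier j
      d_mem := fun i j x hx => by
        obtain ⟨y, hy, z, hz, rfl⟩ := Submodule.mem_sup.1 hx
        rw [map_add]
        exact Submodule.add_mem_sup (S.d_mem i j y hy) (T.d_mem i j z hz) }
  inf_le_left _ _ := fun _ => inf_le_left
  inf_le_right _ _ := fun _ => inf_le_right
  le_inf _ _ _ h₁ h₂ := fun j => le_inf (h₁ j) (h₂ j)
  le_sup_left _ _ := fun _ => le_sup_left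
  le_sup_right _ _ := fun _ => le_sup_right
  sup_le _ _ _ h₁ h₂ := fun j => sup_le (h₁ j) (h₂ j)

/-- The zero subcomplex and the whole complex. -/
instance : BoundedOrder (Subcomplex K) where
  top := { carrier := fun _ => ⊤, d_mem := fun _ _ _ _ => trivial }
  bot :=
    { carrier := fun _ => ⊥
      d_mem := fun i j x hx => by
        rw [(Submodule.mem_bot R).1 hx, map_zero]; exact Submodule.zero_mem _ }
  le_top _ := fun _ => le_top
  bot_le _ := fun _ => bot_le

/-- The module `T^j / (S^j ∩ T^j)`, which is `T^j / S^j` when `S ≤ T`. -/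
abbrev QuotModule (T S : Subcomplex K) (j : ℤ) : Type v :=
  (T.carrier j) ⧸ (S.carrier j).submoduleOf (T.carrier j)

/-- The differential of `T / S`, induced by the one of `K`. -/
def quotD (T S : Subcomplex K) (i j : ℤ) : QuotModule T S i →ₗ[R] QuotModule T S j :=
  Submodule.mapQ _ _ ((K.d i j).hom.restrict (T.d_mem i j)) fun x hx => S.d_mem i j x.1 hx

/-- The quotient complex `T / S` of a subcomplex `T` by a smaller subcomplex `S`. -/
def quot (T S : Subcomplex K) : CochainComplex (ModuleCat.{v} R) ℤ where
  X j := ModuleCat.of R (QuotModule T S j)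
  d i j := ModuleCat.ofHom (quotD T S i j)
  shape i j h := by
    ext x
    refine (Submodule.Quotient.mk_eq_zero _).2 ?_
    change (K.d i j).hom x.1 ∈ S.carrier j
    rw [K.shape i j h]
    exact Submodule.zero_mem _
  d_comp_d' i j k _ _ := by
    ext x
    refine (Submodule.Quotient.mk_eq_zero _).2 ?_
    change (K.d j k).hom ((K.d i j).hom x.1) ∈ S.carrier k
    rw [← LinearMap.comp_apply, ← ModuleCat.hom_comp, K.d_comp_d]
    exact Submodule.zero_mem _

/-- The canonical morphism `T / S ⟶ T' / S'` for `S ≤ S'` and `T ≤ T'`. -/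
def quotMap {T S T' S' : Subcomplex K} (hT : T ≤ T') (hS : S ≤ S') : quot T S ⟶ quot T' S' where
  f j := ModuleCat.ofHom
    (Submodule.mapQ _ _ (Submodule.inclusion (hT j)) fun _ hx => hS j hx)
  comm' i j _ := by
    ext x
    obtain ⟨x, rfl⟩ := Submodule.Quotient.mk_surjective _ x
    rfl

/-- The sequence of canonical morphisms `T₁ / S₁ ⟶ T₂ / S₂ ⟶ T₃ / S₃`, whose composition is zero
because `T₁ ≤ S₃`. -/
def quotSeq {T₁ S₁ T₂ S₂ T₃ S₃ : Subcomplex K} (hT : T₁ ≤ T₂) (hS : S₁ ≤ S₂)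
    (hT' : T₂ ≤ T₃) (hS' : S₂ ≤ S₃) (h : T₁ ≤ S₃) :
    ShortComplex (CochainComplex (ModuleCat.{v} R) ℤ) :=
  ShortComplex.mk (quotMap hT hS) (quotMap hT' hS') (by
    ext j x
    obtain ⟨x, rfl⟩ := Submodule.Quotient.mk_surjective _ x
    exact (Submodule.Quotient.mk_eq_zero _).2 (h j x.2))

/-- `0 → H^j(T₁ / S₁) → H^j(T₂ / S₂) → H^j(T₃ / S₃) → 0` is exact for every `j`. -/
def CohomologyShortExact (C : ShortComplex (CochainComplex (ModuleCat.{v} R) ℤ)) : Prop :=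
  ∀ j : ℤ, (C.map (HomologicalComplex.homologyFunctor (ModuleCat.{v} R) (.up ℤ) j)).ShortExact

/-- Strictness of `(K; S, T)` for two subcomplexes `S`, `T` of `K`: in the `3 × 3` diagram of
complexes with short exact rows and columns

  `S ∩ T       →  S            →  S / (S ∩ T)`
  `T           →  K            →  K / T`
  `T / (S ∩ T) →  K / S        →  K / (S + T)`

all the rows and columns stay short exact after taking the cohomology `H^j`, for every `j`. -/
structure StrictPair (S T : Subcomplex K) : Prop where
  row₁ : CohomologyShortExact
    (quotSeq (T₁ := S ⊓ T) (S₁ := ⊥) (T₂ := S) (S₂ := ⊥) (T₃ := S) (S₃ := S ⊓ T)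
      inf_le_left le_rfl le_rfl bot_le le_rfl)
  row₂ : CohomologyShortExact
    (quotSeq (T₁ := T) (S₁ := ⊥) (T₂ := ⊤) (S₂ := ⊥) (T₃ := ⊤) (S₃ := T)
      le_top le_rfl le_rfl bot_le le_rfl)
  row₃ : CohomologyShortExact
    (quotSeq (T₁ := T) (S₁ := S ⊓ T) (T₂ := ⊤) (S₂ := S) (T₃ := ⊤) (S₃ := S ⊔ T)
      le_top inf_le_left le_rfl le_sup_left le_sup_right)
  col₁ : CohomologyShortExact
    (quotSeq (T₁ := S ⊓ T) (S₁ := ⊥) (T₂ := T) (S₂ := ⊥) (T₃ := T) (S₃ := S ⊓ T)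
      inf_le_right le_rfl le_rfl bot_le le_rfl)
  col₂ : CohomologyShortExact
    (quotSeq (T₁ := S) (S₁ := ⊥) (T₂ := ⊤) (S₂ := ⊥) (T₃ := ⊤) (S₃ := S)
      le_top le_rfl le_rfl bot_le le_rfl)
  col₃ : CohomologyShortExact
    (quotSeq (T₁ := S) (S₁ := S ⊓ T) (T₂ := ⊤) (S₂ := T) (T₃ := ⊤) (S₃ := S ⊔ T)
      le_top inf_le_right le_rfl le_sup_right le_sup_left)

end Subcomplex

/-- A complex with an increasing filtration `F` indexed by `ℤ` and a decreasing filtration `U`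
indexed by `ℚ`. -/
structure BifilteredComplex (R : Type u) [Ring R] where
  K : CochainComplex (ModuleCat.{v} R) ℤ
  F : ℤ → Subcomplex K
  U : ℚ → Subcomplex K
  F_mono : Monotone F
  U_anti : Antitone U

/-- The bifiltered complex `(K; F, U)` is strict: `(K; F_p K, U^α K)` is strict for
all `p` and `α`. -/
def BifilteredComplex.IsStrict (C : BifilteredComplex.{u, v} R) : Prop :=
  ∀ (p : ℤ) (α : ℚ), Subcomplex.StrictPair (C.F p) (C.U α)

end Bifiltered

/-! ## Convergent power series -/

namespace GaussManin

noncomputable section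

/-- The formal power series `a` converges absolutely on some polydisc of positive radius. -/
def IsConvergent {n : ℕ} (a : MvPowerSeries (Fin n) ℂ) : Prop :=
  ∃ r : ℝ, 0 < r ∧ Summable fun ν : Fin n →₀ ℕ => ‖MvPowerSeries.coeff ν a‖ * r ^ ν.degree

theorem IsConvergent.anti {n : ℕ} {a : MvPowerSeries (Fin n) ℂ} {r s : ℝ} (hs : 0 < s)
    (hsr : s ≤ r) (h : Summable fun ν : Fin n →₀ ℕ => ‖MvPowerSeries.coeff ν a‖ * r ^ ν.degree) :
    Summable fun ν : Fin n →₀ ℕ => ‖MvPowerSeries.coeff ν a‖ * s ^ ν.degree :=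
  Summable.of_nonneg_of_le (fun ν => by positivity) (fun ν => by gcongr) h

theorem IsConvergent.of_finite {n : ℕ} {a : MvPowerSeries (Fin n) ℂ}
    (h : {ν | MvPowerSeries.coeff ν a ≠ 0}.Finite) : IsConvergent a := by
  refine ⟨1, one_pos, summable_of_hasFiniteSupport (h.subset fun ν hν h0 => hν ?_)⟩
  simp [h0]

theorem IsConvergent.add {n : ℕ} {a b : MvPowerSeries (Fin n) ℂ} (ha : IsConvergent a)
    (hb : IsConvergent b) : IsConvergent (a + b) := by
  obtain ⟨r, hr, ha⟩ := ha
  obtain ⟨s, hs, hb⟩ := hb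
  have ht : 0 < min r s := lt_min hr hs
  refine ⟨min r s, ht, Summable.of_nonneg_of_le (fun ν => by positivity) (fun ν => ?_)
    ((IsConvergent.anti ht (min_le_left r s) ha).add (IsConvergent.anti ht (min_le_right r s) hb))⟩
  rw [map_add, ← add_mul]
  gcongr
  exact norm_add_le _ _

theorem IsConvergent.mul {n : ℕ} {a b : MvPowerSeries (Fin n) ℂ} (ha : IsConvergent a)
    (hb : IsConvergent b) : IsConvergent (a * b) := by
  classical
  obtain ⟨r, hr, ha⟩ := ha
  obtain ⟨s, hs, hb⟩ := hb
  have ht : 0 < min r s := lt_min hr hs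
  replace ha := IsConvergent.anti ht (min_le_left r s) ha
  replace hb := IsConvergent.anti ht (min_le_right r s) hb
  set t := min r s
  have hab : Summable fun ν : Fin n →₀ ℕ => ∑ p ∈ Finset.HasAntidiagonal.antidiagonal ν,
      (‖MvPowerSeries.coeff p.1 a‖ * t ^ p.1.degree) *
        (‖MvPowerSeries.coeff p.2 b‖ * t ^ p.2.degree) :=
    summable_sum_mul_antidiagonal_of_summable_mul
      (f := fun ν : Fin n →₀ ℕ => ‖MvPowerSeries.coeff ν a‖ * t ^ ν.degree)
      (g := fun ν : Fin n →₀ ℕ => ‖MvPowerSeries.coeff ν b‖ * t ^ ν.degree)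
      (ha.mul_of_nonneg hb (fun ν => by dsimp only [Pi.zero_apply]; positivity)
        (fun ν => by dsimp only [Pi.zero_apply]; positivity))
  refine ⟨t, ht, hab.of_nonneg_of_le (fun ν => by positivity) (fun ν => ?_)⟩
  rw [MvPowerSeries.coeff_mul]
  refine (mul_le_mul_of_nonneg_right (norm_sum_le _ _) (by positivity)).trans ?_
  rw [Finset.sum_mul]
  refine Finset.sum_le_sum fun p hp => le_of_eq ?_
  rw [← Finset.HasAntidiagonal.mem_antidiagonal.1 hp, map_add, pow_add, norm_mul]
  ring

theorem IsConvergent.pderiv {n : ℕ} {a : MvPowerSeries (Fin n) ℂ} (ha : IsConvergent a)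
    (k : Fin n) : IsConvergent (MvPowerSeries.pderiv ℂ k a) := by
  obtain ⟨r, hr, ha⟩ := ha
  have hinj : Function.Injective fun ν : Fin n →₀ ℕ => ν + Finsupp.single k 1 :=
    add_left_injective _
  refine ⟨r / 2, by positivity, Summable.of_nonneg_of_le (fun ν => by positivity) (fun ν => ?_)
    ((ha.comp_injective hinj).mul_left r⁻¹)⟩
  have h1 : ((ν k : ℝ) + 1) ≤ 2 ^ ν.degree := by
    have h2 : ν k ≤ ν.degree := Finsupp.le_degree k ν
    have h3 : ν.degree + 1 ≤ 2 ^ ν.degree := Nat.lt_two_pow_self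
    exact_mod_cast (Nat.add_le_add_right h2 1).trans h3
  have h4 : ‖(ν k : ℂ) + 1‖ = (ν k : ℝ) + 1 := by
    rw [← Nat.cast_succ, Complex.norm_natCast, Nat.cast_succ]
  simp only [Function.comp_apply, MvPowerSeries.coeff_pderiv, norm_mul, h4, map_add,
    Finsupp.degree_single, pow_add, pow_one, div_pow]
  calc _ = (‖MvPowerSeries.coeff (ν + Finsupp.single k 1) a‖ * r ^ ν.degree) *
        (((ν k : ℝ) + 1) / 2 ^ ν.degree) := by ring
    _ ≤ (‖MvPowerSeries.coeff (ν + Finsupp.single k 1) a‖ * r ^ ν.degree) * 1 := by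
        gcongr
        exact div_le_one_of_le₀ h1 (by positivity)
    _ = _ := by field_simp

/-- The convergent power series form a subalgebra of the formal power series. -/
def convergentSubalgebra (n : ℕ) : Subalgebra ℂ (MvPowerSeries (Fin n) ℂ) where
  carrier := {a | IsConvergent a}
  mul_mem' := IsConvergent.mul
  add_mem' := IsConvergent.add
  algebraMap_mem' c := IsConvergent.of_finite (by
    classical
    refine (Set.finite_singleton (0 : Fin n →₀ ℕ)).subset fun ν hν => ?_
    by_contra h
    refine hν ?_
    rw [MvPowerSeries.algebraMap_apply, MvPowerSeries.coeff_C]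
    exact if_neg h)

/-- The ring `ℂ{x₁, …, xₙ}` of convergent power series, i.e. the local ring at a point of the
structure sheaf of a complex manifold with chosen local coordinates `x₁, …, xₙ`. -/
def ConvergentSeries (n : ℕ) : Type := convergentSubalgebra n

instance (n : ℕ) : CommRing (ConvergentSeries n) :=
  inferInstanceAs (CommRing (convergentSubalgebra n))

instance (n : ℕ) : Algebra ℂ (ConvergentSeries n) :=
  inferInstanceAs (Algebra ℂ (convergentSubalgebra n))

/-- The inclusion `ℂ{x₁, …, xₙ} ⊆ ℂ⟦x₁, …, xₙ⟧`. -/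
def toSeries {n : ℕ} : ConvergentSeries n →ₐ[ℂ] MvPowerSeries (Fin n) ℂ :=
  (convergentSubalgebra n).val

theorem toSeries_injective {n : ℕ} :
    Function.Injective (toSeries : ConvergentSeries n → MvPowerSeries (Fin n) ℂ) :=
  Subtype.val_injective

/-- The partial derivative `∂ₖ` on `ℂ{x₁, …, xₙ}`. -/
def partialDeriv {n : ℕ} (k : Fin n) : ConvergentSeries n →ₗ[ℂ] ConvergentSeries n where
  toFun a := ⟨MvPowerSeries.pderiv ℂ k (toSeries a), IsConvergent.pderiv a.2 k⟩
  map_add' _ _ := toSeries_injective ((MvPowerSeries.pderiv ℂ k).map_add _ _)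
  map_smul' c _ := toSeries_injective ((MvPowerSeries.pderiv ℂ k).map_smul c _)

theorem toSeries_partialDeriv {n : ℕ} (k : Fin n) (a : ConvergentSeries n) :
    toSeries (partialDeriv k a) = MvPowerSeries.pderiv ℂ k (toSeries a) := rfl

theorem partialDeriv_mul {n : ℕ} (k : Fin n) (a b : ConvergentSeries n) :
    partialDeriv k (a * b) = a * partialDeriv k b + b * partialDeriv k a :=
  toSeries_injective ((MvPowerSeries.pderiv ℂ k).leibniz (toSeries a) (toSeries b))

theorem partialDeriv_comm {n : ℕ} (k l : Fin n) (a : ConvergentSeries n) :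
    partialDeriv k (partialDeriv l a) = partialDeriv l (partialDeriv k a) := by
  refine toSeries_injective (MvPowerSeries.ext fun ν => ?_)
  rcases eq_or_ne k l with rfl | h
  · rfl
  simp only [toSeries_partialDeriv, MvPowerSeries.coeff_pderiv, Finsupp.add_apply,
    Finsupp.single_eq_of_ne h, Finsupp.single_eq_of_ne h.symm,
    add_right_comm ν (Finsupp.single k 1) (Finsupp.single l 1)]
  push_cast
  ring

/-! ## Semiquasihomogeneous isolated singularities -/

/-- The polynomial `g` is quasihomogeneous of weight `w` (all its monomials `x^ν` satisfy
`∑ᵢ wᵢ νᵢ = 1`) and has an isolated singularity at the origin: the origin is isolated among the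
common zeros of the partial derivatives of `g`. -/
def IsQuasihomogeneousIsolated {n : ℕ} (w : Fin n → ℚ) (g : MvPolynomial (Fin n) ℂ) : Prop :=
  MvPolynomial.IsWeightedHomogeneous w g 1 ∧
    ∀ᶠ z : Fin n → ℂ in nhdsWithin 0 {0}ᶜ,
      ∃ i, MvPolynomial.eval z (MvPolynomial.pderiv i g) ≠ 0

/-- `f = f' + f''` is semiquasihomogeneous of weight `w`: `f'` is a quasihomogeneous polynomial of
weight `w` with isolated singularity at the origin, and only monomials `x^ν` with
`∑ᵢ wᵢ νᵢ > 1` occur in `f''`. -/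
def IsSemiquasihomogeneous {n : ℕ} (w : Fin n → ℚ) (f : ConvergentSeries n) : Prop :=
  ∃ (f' : MvPolynomial (Fin n) ℂ) (f'' : ConvergentSeries n),
    IsQuasihomogeneousIsolated w f' ∧
    (∀ ν : Fin n →₀ ℕ, Finsupp.weight w ν ≤ 1 →
      MvPowerSeries.coeff ν (toSeries f'') = 0) ∧
    toSeries f = (f' : MvPowerSeries (Fin n) ℂ) + toSeries f''

/-! ## The microlocal module `A[∂ₜ, ∂ₜ⁻¹]` and its filtrations, where `A = ℂ{x₁, …, xₙ}` -/

/-- `A[∂ₜ, ∂ₜ⁻¹]`: the finite sums `∑ᵢ aᵢ ⊗ ∂ₜ^i` with `i ∈ ℤ`, given by their coefficients. -/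
abbrev Micro (n : ℕ) : Type := ℤ →₀ ConvergentSeries n

/-- The action of `∂ₖ`: `∂ₖ (a ⊗ ∂ₜ^i) = ∂ₖ a ⊗ ∂ₜ^i - (∂ₖ f) a ⊗ ∂ₜ^(i+1)`. -/
def microD {n : ℕ} (f : ConvergentSeries n) (k : Fin n) : Micro n →ₗ[ℂ] Micro n :=
  (Finsupp.mapRange.linearMap (partialDeriv k) : Micro n →ₗ[ℂ] Micro n) -
    (Finsupp.lmapDomain (ConvergentSeries n) ℂ fun i : ℤ => i + 1) ∘ₗ
      (Finsupp.mapRange.linearMap (LinearMap.mulLeft ℂ (partialDeriv k f)) :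
        Micro n →ₗ[ℂ] Micro n)

theorem microD_apply {n : ℕ} (f : ConvergentSeries n) (k : Fin n) (x : Micro n) (i : ℤ) :
    microD f k x i = partialDeriv k (x i) - partialDeriv k f * x (i - 1) := by
  have h : ∀ y : Micro n, Finsupp.mapDomain (fun j : ℤ => j + 1) y i = y (i - 1) := fun y => by
    conv_lhs => rw [← sub_add_cancel i 1]
    exact Finsupp.mapDomain_apply (add_left_injective 1) y (i - 1)
  simp [microD, h]

theorem microD_comm {n : ℕ} (f : ConvergentSeries n) (k l : Fin n) (x : Micro n) :
    microD f k (microD f l x) = microD f l (microD f k x) := by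
  ext1 i
  simp only [microD_apply, map_sub, partialDeriv_mul, partialDeriv_comm k l]
  ring

/-- `F_p = ⨁_{i ≤ p} A ⊗ ∂ₜ^i`. -/
def microF (n : ℕ) (p : ℤ) : Submodule ℂ (Micro n) where
  carrier := {x | ∀ i, p < i → x i = 0}
  zero_mem' _ _ := rfl
  add_mem' hx hy i hi := by rw [Finsupp.add_apply, hx i hi, hy i hi, add_zero]
  smul_mem' c x hx i hi := by rw [Finsupp.smul_apply, hx i hi, smul_zero]

/-- `U^α A`: the convergent power series all of whose monomials `x^ν` satisfy
`∑ᵢ wᵢ (νᵢ + 1) ≥ α`. -/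
def ringU {n : ℕ} (w : Fin n → ℚ) (α : ℚ) : Submodule ℂ (ConvergentSeries n) where
  carrier := {a | ∀ ν : Fin n →₀ ℕ,
    MvPowerSeries.coeff ν (toSeries a) ≠ 0 → α ≤ ∑ i, w i * (ν i + 1)}
  zero_mem' ν h := absurd (by rw [map_zero, map_zero]) h
  add_mem' {a b} ha hb ν h := by
    by_contra hα
    have ha' := not_not.1 fun h' => hα (ha ν h')
    have hb' := not_not.1 fun h' => hα (hb ν h')
    exact h (by rw [map_add, map_add, ha', hb', add_zero])
  smul_mem' c a ha ν h := ha ν fun h' => h (by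
    rw [map_smul, MvPowerSeries.coeff_smul, h', mul_zero])

/-- `U^α = ⨁_i U^(α+i) A ⊗ ∂ₜ^i`. -/
def microU {n : ℕ} (w : Fin n → ℚ) (α : ℚ) : Submodule ℂ (Micro n) where
  carrier := {x | ∀ i : ℤ, x i ∈ ringU w (α + i)}
  zero_mem' _ := Submodule.zero_mem _
  add_mem' hx hy i := Submodule.add_mem _ (hx i) (hy i)
  smul_mem' c _ hx i := Submodule.smul_mem _ c (hx i)

/-! ## The Koszul complex -/

/-- The term of degree `m` of the Koszul complex shifted by `n`: the direct sum of the
`A[∂ₜ, ∂ₜ⁻¹] ⊗ dx_I` for `I ⊆ {1, …, n}` with `m + n` elements. -/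
abbrev KoszulTerm (n : ℕ) (m : ℤ) : Type :=
  {I : Finset (Fin n) // (I.card : ℤ) = m + n} → Micro n

theorem card_erase_eq {n : ℕ} {m m' : ℤ} (h : m + 1 = m')
    (I : {I : Finset (Fin n) // (I.card : ℤ) = m' + n}) (k : Fin n) (hk : k ∈ I.1) :
    ((I.1.erase k).card : ℤ) = m + n := by
  have h1 := Finset.card_erase_add_one hk
  have h2 := I.2
  omega

/-- The sign `±1` in `dx_k ∧ dx_(I \ k) = ± dx_I` for `k ∈ I`. -/
def koszulSign {n : ℕ} (I : Finset (Fin n)) (k : Fin n) : ℤ :=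
  (-1) ^ (I.filter fun l => l < k).card

/-- The Koszul differential `d (ω ⊗ dx_J) = ∑ₖ ∂ₖ ω ⊗ dx_k ∧ dx_J`, by its coefficient
at `dx_I`. -/
def koszulD {n : ℕ} (f : ConvergentSeries n) {m m' : ℤ} (h : m + 1 = m') :
    KoszulTerm n m →ₗ[ℂ] KoszulTerm n m' :=
  LinearMap.pi fun I => ∑ k ∈ I.1.attach,
    koszulSign I.1 k.1 • (microD f k.1 ∘ₗ
      (LinearMap.proj ⟨I.1.erase k.1, card_erase_eq h I k.1 k.2⟩ : KoszulTerm n m →ₗ[ℂ] Micro n))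

theorem koszulD_apply {n : ℕ} (f : ConvergentSeries n) {m m' : ℤ} (h : m + 1 = m')
    (ω : KoszulTerm n m) (I : {I : Finset (Fin n) // (I.card : ℤ) = m' + n}) :
    koszulD f h ω I = ∑ k ∈ I.1.attach, koszulSign I.1 k.1 •
      microD f k.1 (ω ⟨I.1.erase k.1, card_erase_eq h I k.1 k.2⟩) := by
  simp [koszulD]

theorem koszulSign_swap {n : ℕ} (I : Finset (Fin n)) {k l : Fin n} (hk : k ∈ I)
    (hkl : k < l) :
    koszulSign I k * koszulSign (I.erase k) l = -(koszulSign I l * koszulSign (I.erase l) k) := by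
  have h1 : (I.erase l).filter (fun j => j < k) = I.filter fun j => j < k := by
    ext j; simp only [Finset.mem_filter, Finset.mem_erase]
    exact ⟨fun h => ⟨h.1.2, h.2⟩, fun h => ⟨⟨(h.2.trans hkl).ne, h.1⟩, h.2⟩⟩
  have h2 : (I.erase k).filter (fun j => j < l) = (I.filter fun j => j < l).erase k := by
    ext j; simp only [Finset.mem_filter, Finset.mem_erase]; tauto
  have h3 := Finset.card_erase_add_one (s := I.filter fun j => j < l) (a := k)
    (Finset.mem_filter.2 ⟨hk, hkl⟩)
  simp only [koszulSign, h1, h2]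
  rw [← h3, pow_succ]
  ring

theorem koszulD_koszulD {n : ℕ} (f : ConvergentSeries n) {m m' m'' : ℤ} (h : m + 1 = m')
    (h' : m' + 1 = m'') (ω : KoszulTerm n m) : koszulD f h' (koszulD f h ω) = 0 := by
  classical
  funext I
  -- extend the form by zero, so that the double sum runs over pairs of indices
  let e : Finset (Fin n) → Micro n := fun J => if hJ : (J.card : ℤ) = m + n then ω ⟨J, hJ⟩ else 0
  let g : Fin n → Fin n → Micro n := fun k l =>
    (koszulSign I.1 k * koszulSign (I.1.erase k) l) •
      microD f k (microD f l (e ((I.1.erase k).erase l)))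
  have key : koszulD f h' (koszulD f h ω) I = ∑ k ∈ I.1, ∑ l ∈ I.1.erase k, g k l := by
    rw [koszulD_apply, ← Finset.sum_attach I.1]
    refine Finset.sum_congr rfl fun k _ => ?_
    rw [koszulD_apply, map_sum, Finset.smul_sum, ← Finset.sum_attach (I.1.erase k.1)]
    refine Finset.sum_congr rfl fun l _ => ?_
    have hc := card_erase_eq h ⟨I.1.erase k.1, card_erase_eq h' I k.1 k.2⟩ l.1 l.2
    simp only [g, e, dif_pos hc, map_zsmul, smul_smul]
  have anti : ∀ k ∈ I.1, ∀ l ∈ I.1, k ≠ l → g k l = -g l k := by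
    intro k hk l hl hkl
    simp only [g]
    rw [microD_comm f k l, Finset.erase_right_comm, ← neg_smul]
    congr 1
    rcases lt_or_gt_of_ne hkl with hlt | hlt
    · exact koszulSign_swap I.1 hk hlt
    · rw [koszulSign_swap I.1 hl hlt, neg_neg]
  have self : ∑ k ∈ I.1, ∑ l ∈ I.1.erase k, g k l = -∑ k ∈ I.1, ∑ l ∈ I.1.erase k, g k l := by
    conv_lhs => rw [Finset.sum_comm' (t' := I.1) (s' := fun l => I.1.erase l)
      (by intro x y; simp only [Finset.mem_erase]; tauto)]
    rw [← Finset.sum_neg_distrib]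
    refine Finset.sum_congr rfl fun k hk => ?_
    rw [← Finset.sum_neg_distrib]
    refine Finset.sum_congr rfl fun l hl => ?_
    exact anti l (Finset.mem_of_mem_erase hl) k hk (Finset.ne_of_mem_erase hl)
  rw [key]
  have two : (2 : ℂ) • ∑ k ∈ I.1, ∑ l ∈ I.1.erase k, g k l = 0 := by
    rw [two_smul]
    exact add_eq_zero_iff_eq_neg.2 self
  exact (smul_eq_zero.1 two).resolve_left two_ne_zero

/-- The microlocal Gauss–Manin complex `K_f`: the Koszul complex of `∂₁, …, ∂ₙ` acting on
`A[∂ₜ, ∂ₜ⁻¹]`, shifted by `n`. -/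
def koszul {n : ℕ} (f : ConvergentSeries n) : CochainComplex (ModuleCat.{0} ℂ) ℤ where
  X m := ModuleCat.of ℂ (KoszulTerm n m)
  d m m' := if h : m + 1 = m' then ModuleCat.ofHom (koszulD f h) else 0
  shape _ _ h := dif_neg h
  d_comp_d' m m' m'' h h' := by
    have h₁ : m + 1 = m' := h
    have h₂ : m' + 1 = m'' := h'
    rw [dif_pos h₁, dif_pos h₂]
    ext1
    exact LinearMap.ext fun ω => koszulD_koszulD f h₁ h₂ ω

theorem koszul_d_mem {n : ℕ} (f : ConvergentSeries n) (P : ∀ m : ℤ, Submodule ℂ (KoszulTerm n m))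
    (hP : ∀ (m m' : ℤ) (h : m + 1 = m') (ω : KoszulTerm n m), ω ∈ P m → koszulD f h ω ∈ P m')
    (m m' : ℤ) (ω : (koszul f).X m) (hω : ω ∈ P m) : ((koszul f).d m m').hom ω ∈ P m' := by
  by_cases h : m + 1 = m'
  · have e : (koszul f).d m m' = ModuleCat.ofHom (koszulD f h) := dif_pos h
    rw [e]
    exact hP m m' h ω hω
  · have e : (koszul f).d m m' = 0 := dif_neg h
    rw [e]
    exact Submodule.zero_mem _

theorem microD_mem_microF {n : ℕ} (f : ConvergentSeries n) (k : Fin n) {p : ℤ} {x : Micro n}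
    (hx : x ∈ microF n p) : microD f k x ∈ microF n (p + 1) := by
  intro i hi
  rw [microD_apply, hx i (by omega), hx (i - 1) (by omega), map_zero, mul_zero, sub_zero]

/-- The filtration `F` on `K_f`: on `A[∂ₜ, ∂ₜ⁻¹] ⊗ dx_I` with `I` of cardinality `j`, that is in
degree `m = j - n`, the subcomplex `F_p` is given by `F_(p + j - n)`. -/
def koszulF {n : ℕ} (f : ConvergentSeries n) (p : ℤ) : Bifiltered.Subcomplex (koszul f) where
  carrier m := (Submodule.pi Set.univ fun _ => microF n (p + m) : Submodule ℂ (KoszulTerm n m))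
  d_mem := koszul_d_mem f _ fun m m' h ω hω I _ => by
    rw [koszulD_apply]
    refine Submodule.sum_mem _ fun k _ => zsmul_mem ?_ _
    have h1 := microD_mem_microF f k.1 (hω ⟨I.1.erase k.1, card_erase_eq h I k.1 k.2⟩ trivial)
    rw [add_assoc, h] at h1
    exact h1

theorem partialDeriv_mem_ringU {n : ℕ} {w : Fin n → ℚ} (k : Fin n) {α : ℚ} {a : ConvergentSeries n}
    (ha : a ∈ ringU w α) : partialDeriv k a ∈ ringU w (α - w k) := by
  intro ν hν
  have h : MvPowerSeries.coeff (ν + Finsupp.single k 1) (toSeries a) ≠ 0 := by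
    intro h0
    refine hν ?_
    rw [toSeries_partialDeriv, MvPowerSeries.coeff_pderiv, h0, zero_mul]
  have h1 := ha _ h
  have h2 : ∑ i, w i * (((ν + Finsupp.single k 1 : Fin n →₀ ℕ) i : ℚ) + 1) =
      ∑ i, w i * ((ν i : ℚ) + 1) + w k := by
    classical
    simp [mul_add, Finset.sum_add_distrib, Finsupp.single_apply]
    ring
  linarith

theorem mul_mem_ringU {n : ℕ} {w : Fin n → ℚ} {α β : ℚ} {a b : ConvergentSeries n}
    (ha : a ∈ ringU w (α + ∑ i, w i)) (hb : b ∈ ringU w β) : a * b ∈ ringU w (α + β) := by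
  classical
  intro ν hν
  have hc : MvPowerSeries.coeff ν (toSeries a * toSeries b) ≠ 0 := by
    rwa [← map_mul]
  rw [MvPowerSeries.coeff_mul] at hc
  obtain ⟨p, hp, hp0⟩ := Finset.exists_ne_zero_of_sum_ne_zero hc
  have h1 := ha _ (left_ne_zero_of_mul hp0)
  have h2 := hb _ (right_ne_zero_of_mul hp0)
  rw [← Finset.HasAntidiagonal.mem_antidiagonal.1 hp]
  have h3 : ∑ i, w i * (((p.1 + p.2 : Fin n →₀ ℕ) i : ℚ) + 1) + ∑ i, w i =
      ∑ i, w i * ((p.1 i : ℚ) + 1) + ∑ i, w i * ((p.2 i : ℚ) + 1) := by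
    rw [← Finset.sum_add_distrib, ← Finset.sum_add_distrib]
    refine Finset.sum_congr rfl fun i _ => ?_
    rw [Finsupp.add_apply]; push_cast; ring
  linarith

theorem IsSemiquasihomogeneous.mem_ringU {n : ℕ} {w : Fin n → ℚ} {f : ConvergentSeries n}
    (hf : IsSemiquasihomogeneous w f) : f ∈ ringU w (1 + ∑ i, w i) := by
  obtain ⟨f', f'', ⟨hq, -⟩, h'', hff⟩ := hf
  intro ν hν
  have h1 : 1 ≤ Finsupp.weight w ν := by
    by_contra! hlt
    refine hν ?_
    have : MvPolynomial.coeff ν f' = 0 := not_not.1 fun h0 => hlt.ne (hq h0)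
    rw [hff, map_add, h'' ν hlt.le, MvPolynomial.coeff_coe, this, add_zero]
  have h2 : Finsupp.weight w ν = ∑ i, (ν i : ℚ) * w i := by
    rw [Finsupp.weight_apply, Finsupp.sum_fintype _ _ (by simp)]
    simp
  have h3 : ∑ i, w i * ((ν i : ℚ) + 1) = ∑ i, (ν i : ℚ) * w i + ∑ i, w i := by
    rw [← Finset.sum_add_distrib]
    exact Finset.sum_congr rfl fun i _ => by ring
  linarith

theorem microD_mem_microU {n : ℕ} {w : Fin n → ℚ} {f : ConvergentSeries n}
    (hf : IsSemiquasihomogeneous w f) (k : Fin n) {α : ℚ} {x : Micro n}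
    (hx : x ∈ microU w α) : microD f k x ∈ microU w (α - w k) := by
  intro i
  rw [microD_apply]
  refine Submodule.sub_mem _ ?_ ?_
  · have h := partialDeriv_mem_ringU k (hx i)
    rwa [add_sub_right_comm] at h
  · have h1 : partialDeriv k f ∈ ringU w ((1 - w k) + ∑ i, w i) := by
      have h := partialDeriv_mem_ringU k hf.mem_ringU
      rwa [add_sub_right_comm] at h
    have h2 := mul_mem_ringU h1 (hx (i - 1))
    have h3 : (1 - w k) + (α + ((i - 1 : ℤ) : ℚ)) = α - w k + i := by push_cast; ring
    rwa [h3] at h2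

/-- The filtration `U` on `K_f`: on `A[∂ₜ, ∂ₜ⁻¹] ⊗ dx_I`, the subcomplex `U^α` is given by
`U^(α + w')` with `w' = ∑ᵢ wᵢ - ∑_(k ∈ I) wₖ`, where `∑ᵢ wᵢ` is the minimal exponent of the
quasihomogeneous part of `f`. -/
def koszulU {n : ℕ} {w : Fin n → ℚ} {f : ConvergentSeries n} (hf : IsSemiquasihomogeneous w f) (α : ℚ) :
    Bifiltered.Subcomplex (koszul f) where
  carrier m := (Submodule.pi Set.univ fun I =>
    microU w (α + (∑ i, w i - ∑ k ∈ I.1, w k)) : Submodule ℂ (KoszulTerm n m))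
  d_mem := koszul_d_mem f _ fun m m' h ω hω I _ => by
    rw [koszulD_apply]
    refine Submodule.sum_mem _ fun k _ => zsmul_mem ?_ _
    have h1 := microD_mem_microU hf k.1 (hω ⟨I.1.erase k.1, card_erase_eq h I k.1 k.2⟩ trivial)
    have h2 : α + (∑ i, w i - ∑ j ∈ I.1.erase k.1, w j) - w k.1 =
        α + (∑ i, w i - ∑ j ∈ I.1, w j) := by
      rw [← Finset.sum_erase_add _ _ k.2]; ring
    simp only [h2] at h1
    exact h1

/-- The bifiltered complex `(K_f; F, U)`. -/
def bifilteredKoszul {n : ℕ} {w : Fin n → ℚ} {f : ConvergentSeries n}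
    (hf : IsSemiquasihomogeneous w f) : Bifiltered.BifilteredComplex.{0, 0} ℂ where
  K := koszul f
  F := koszulF f
  U := koszulU hf
  F_mono p q hpq _ _ hω I _ i hi := hω I trivial i (by omega)
  U_anti α β hαβ _ _ hω I _ i ν hν := le_trans (by linarith) (hω I trivial i ν hν)

end

end GaussManin

/-! If a subcomplex inclusion is injective on cohomology, the long exact sequence splits into short
ones. All six injectivity statements needed for strictness of a pair `S`, `T` follow from one
property of `S`, `T`, `S ⊓ T` and `S ⊔ T`: a boundary of `K` lying in the subcomplex is the boundary
of one of its elements (`BoundaryStrict`, `StrictPair.of_boundaryStrict`).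

For `K_f`, let the level of `a ⊗ ∂ₜ^i ⊗ dx_I` be `q = i - |I|`. The differential is then the
exterior derivative from level `q + 1` to level `q`, minus `df ∧` inside each level (`comp_gmD`).
With integral weights `W = D w`, and with `dx_I` given weight `∑ (D - W_k)` over `k ∈ I`, `df ∧`
does not lower the order and the exterior derivative lowers it by at most `D`. In these terms `F_p`
means that the levels above `p - n` vanish, and `U^α` means that level `q` has order at least `⌈α D⌉
+ q D`. So all four subcomplexes are described by conditions on single levels.

The essential input is that `df ∧` is exact below degree `n`, also on the graded pieces for the
weight. By the Nullstellensatz the Jacobian ideal of the quasihomogeneous part `g` contains powers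
of all coordinates; Nakayama's lemma carries this over to `f`. Since `x₁^N, …, xₙ^N` is a regular
sequence, depth sensitivity of the Koszul complex applies (`exists_smulD_eq`).

Given `x` of degree below `n` whose boundary satisfies the conditions, `x` is corrected by
boundaries from the top level downwards. For `F`, the top component is a `df ∧`-cycle and is removed
(`exists_comp_eq_zero`). For `U`, the leading weighted part of each component is a `dg ∧`-cycle and
is removed, one unit of weight at a time (`exists_comp_mem_formGE`). Finitely many steps suffice,
because only finitely many levels are nonzero and low orders impose no condition. No convergence
question arises. -/

namespace Bifiltered

universe u v

variable {R : Type u} [Ring R]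

/-! ### Strictness of a pair from strictness of boundaries -/

/-- Injectivity on homology, in terms of elements. -/
theorem mono_homologyMap_of_exists {X Y : CochainComplex (ModuleCat.{v} R) ℤ} (φ : X ⟶ Y) (j : ℤ)
    (h : ∀ (x : X.X j) (i : ℤ) (y : Y.X i), (φ.f j).hom x = (Y.d i j).hom y →
      ∃ z : X.X i, x = (X.d i j).hom z) :
    Mono (HomologicalComplex.homologyMap φ j) := by
  rw [ModuleCat.mono_iff_injective]
  refine (injective_iff_map_eq_zero (HomologicalComplex.homologyMap φ j).hom).2 fun a ha => ?_
  obtain ⟨c, rfl⟩ := (ModuleCat.epi_iff_surjective (X.homologyπ j)).1 inferInstance a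
  have hX : ∀ c : X.cycles j, (X.homologyι j).hom ((X.homologyπ j).hom c) =
      (X.pOpcycles j).hom ((X.iCycles j).hom c) := fun c => by
    rw [← LinearMap.comp_apply, ← LinearMap.comp_apply, ← ModuleCat.hom_comp, ← ModuleCat.hom_comp,
      HomologicalComplex.homology_π_ι]
  have h1 : (Y.pOpcycles j).hom ((φ.f j).hom ((X.iCycles j).hom c)) = 0 := by
    rw [← LinearMap.comp_apply, ← ModuleCat.hom_comp, ← HomologicalComplex.p_opcyclesMap,
      ModuleCat.hom_comp, LinearMap.comp_apply, ← hX, ← LinearMap.comp_apply, ← ModuleCat.hom_comp,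
      ← HomologicalComplex.homologyι_naturality, ModuleCat.hom_comp, LinearMap.comp_apply]
    exact (congrArg _ ha).trans (map_zero _)
  obtain ⟨y, hy⟩ := ((Y.sc j).moduleCat_pOpcycles_eq_zero_iff _).1 h1
  obtain ⟨z, hz⟩ := h _ _ y hy.symm
  have h2 : (X.pOpcycles j).hom ((X.iCycles j).hom c) = 0 :=
    ((X.sc j).moduleCat_pOpcycles_eq_zero_iff _).2 ⟨z, hz.symm⟩
  rw [← hX] at h2
  exact (ModuleCat.mono_iff_injective (X.homologyι j)).1 inferInstance (h2.trans (map_zero _).symm)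

namespace Subcomplex

variable {K : CochainComplex (ModuleCat.{v} R) ℤ}

theorem mem_sup_carrier {S T : Subcomplex K} {j : ℤ} {x : K.X j} :
    x ∈ (S ⊔ T).carrier j ↔ ∃ y ∈ S.carrier j, ∃ z ∈ T.carrier j, y + z = x :=
  Submodule.mem_sup

/-- If the first map of a short exact sequence of complexes is injective on cohomology, then
the cohomology sequences split up into short exact ones. -/
theorem cohomologyShortExact_of_mono {C : ShortComplex (CochainComplex (ModuleCat.{v} R) ℤ)}
    (hC : C.ShortExact) (h : ∀ j, Mono (HomologicalComplex.homologyMap C.f j)) :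
    CohomologyShortExact C := by
  intro j
  -- The connecting map followed by the injection on `H^(j+1)` is zero, so it vanishes itself;
  -- exactness then makes the second map on `H^j` surjective.
  have hδ : hC.δ j (j + 1) rfl = 0 := by
    have := h (j + 1)
    rw [← cancel_mono (HomologicalComplex.homologyMap C.f (j + 1)), Limits.zero_comp]
    exact hC.δ_comp j (j + 1) rfl
  have hepi : Epi (HomologicalComplex.homologyMap C.g j) :=
    (hC.homology_exact₃ j (j + 1) rfl).epi_f hδ
  exact { exact := hC.homology_exact₂ j, mono_f := h j, epi_g := hepi }

theorem shortExact_quotSeq {T₁ S₁ T₂ S₂ S₃ : Subcomplex K} (hT : T₁ ≤ T₂) (hS : S₁ ≤ S₂)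
    (hS' : S₂ ≤ S₃) (h : T₁ ≤ S₃) (h₁ : T₁ ⊓ S₂ ≤ S₁) (h₂ : S₃ ≤ T₁ ⊔ S₂) :
    (quotSeq hT hS le_rfl hS' h).ShortExact := by
  refine HomologicalComplex.shortExact_of_degreewise_shortExact _ fun j => ?_
  refine { exact := ?_, mono_f := ?_, epi_g := ?_ }
  · rw [ShortComplex.moduleCat_exact_iff]
    intro x hx
    obtain ⟨x, rfl⟩ := Submodule.Quotient.mk_surjective _ x
    have hx' : x.1 ∈ S₃.carrier j :=
      (Submodule.Quotient.mk_eq_zero ((S₃.carrier j).submoduleOf (T₂.carrier j))).1 hx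
    obtain ⟨t, ht, s, hs, e⟩ := Submodule.mem_sup.1 (h₂ j hx')
    refine ⟨Submodule.Quotient.mk ⟨t, ht⟩, (Submodule.Quotient.eq _).2 ?_⟩
    change t - x.1 ∈ S₂.carrier j
    rw [← e, sub_add_cancel_left]
    exact neg_mem hs
  · refine (ModuleCat.mono_iff_injective _).2 ((injective_iff_map_eq_zero _).2 fun x hx => ?_)
    obtain ⟨x, rfl⟩ := Submodule.Quotient.mk_surjective _ x
    exact (Submodule.Quotient.mk_eq_zero _).2
      (h₁ j ⟨x.2,
        (Submodule.Quotient.mk_eq_zero ((S₂.carrier j).submoduleOf (T₂.carrier j))).1 hx⟩)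
  · refine (ModuleCat.epi_iff_surjective _).2 fun x => ?_
    obtain ⟨x, rfl⟩ := Submodule.Quotient.mk_surjective _ x
    exact ⟨Submodule.Quotient.mk x, rfl⟩

/-- The hypothesis `H` is injectivity of `H^j(T₁/S₁) → H^j(T₂/S₂)` on representatives; `h₁` and `h₂`
give exactness of the sequence of complexes. -/
theorem cohomologyShortExact_quotSeq {T₁ S₁ T₂ S₂ S₃ : Subcomplex K} (hT : T₁ ≤ T₂) (hS : S₁ ≤ S₂)
    (hS' : S₂ ≤ S₃) (h : T₁ ≤ S₃) (h₁ : T₁ ⊓ S₂ ≤ S₁) (h₂ : S₃ ≤ T₁ ⊔ S₂)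
    (H : ∀ (i j : ℤ) (x : K.X j) (y : K.X i), x ∈ T₁.carrier j → y ∈ T₂.carrier i →
      x - (K.d i j).hom y ∈ S₂.carrier j →
      ∃ z ∈ T₁.carrier i, x - (K.d i j).hom z ∈ S₁.carrier j) :
    CohomologyShortExact (quotSeq hT hS le_rfl hS' h) := by
  refine cohomologyShortExact_of_mono (shortExact_quotSeq hT hS hS' h h₁ h₂) fun j => ?_
  refine mono_homologyMap_of_exists _ j fun x i y hxy => ?_
  obtain ⟨x, rfl⟩ := Submodule.Quotient.mk_surjective _ x
  obtain ⟨y, rfl⟩ := Submodule.Quotient.mk_surjective _ y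
  obtain ⟨z, hz, hz'⟩ := H i j x.1 y.1 x.2 y.2
    ((Submodule.Quotient.eq ((S₂.carrier j).submoduleOf (T₂.carrier j))).1 hxy)
  exact ⟨Submodule.Quotient.mk ⟨z, hz⟩, (Submodule.Quotient.eq _).2 hz'⟩

/-- A subcomplex `W` of `K` is strict if every boundary of `K` lying in `W` is a boundary
of `W`. -/
def BoundaryStrict (W : Subcomplex K) : Prop :=
  ∀ (i j : ℤ) (x : K.X i), (K.d i j).hom x ∈ W.carrier j →
    ∃ y ∈ W.carrier i, (K.d i j).hom y = (K.d i j).hom x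

/-- The sequences starting with `S ⊓ T`, `T` or `S` need only boundary strictness of that first
term. The third row and third column are where `S ⊔ T` enters. -/
theorem StrictPair.of_boundaryStrict {S T : Subcomplex K} (hS : S.BoundaryStrict)
    (hT : T.BoundaryStrict) (hinf : (S ⊓ T).BoundaryStrict) (hsup : (S ⊔ T).BoundaryStrict) :
    StrictPair S T := by
  have bot : ∀ {W : Subcomplex K} {j : ℤ} {x y : K.X j},
      x - y ∈ (⊥ : Subcomplex K).carrier j → x ∈ W.carrier j → y ∈ W.carrier j ∧ x = y :=
    fun h hx => by
      have e := sub_eq_zero.1 ((Submodule.mem_bot R).1 h)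
      exact ⟨e ▸ hx, e⟩
  have zero : ∀ {j : ℤ} {x y : K.X j}, x = y → x - y ∈ (⊥ : Subcomplex K).carrier j :=
    fun h => (Submodule.mem_bot R).2 (sub_eq_zero.2 h)
  have sup : ∀ (i j : ℤ) (x : K.X j) (y : K.X i),
      x - (K.d i j).hom y ∈ S.carrier j ⊔ T.carrier j → x ∈ S.carrier j ⊔ T.carrier j →
      ∃ s ∈ S.carrier i, ∃ t ∈ T.carrier i, (K.d i j).hom y =
        (K.d i j).hom s + (K.d i j).hom t := by
    intro i j x y h hx
    have h1 : (K.d i j).hom y ∈ (S ⊔ T).carrier j := by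
      have := Submodule.sub_mem _ hx h
      rwa [sub_sub_cancel] at this
    obtain ⟨z, hz, e⟩ := hsup i j y h1
    obtain ⟨s, hs, t, ht, rfl⟩ := Submodule.mem_sup.1 hz
    exact ⟨s, hs, t, ht, by rw [← e, map_add]⟩
  refine ⟨?_, ?_, ?_, ?_, ?_, ?_⟩
  · refine cohomologyShortExact_quotSeq _ _ _ _ inf_le_right le_sup_left fun i j x y hx hy h => ?_
    obtain ⟨h1, h2⟩ := bot (W := S ⊓ T) h hx
    obtain ⟨z, hz, e⟩ := hinf i j y h1
    exact ⟨z, hz, zero (h2.trans e.symm)⟩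
  · refine cohomologyShortExact_quotSeq _ _ _ _ inf_le_right le_sup_left fun i j x y hx hy h => ?_
    obtain ⟨h1, h2⟩ := bot (W := T) h hx
    obtain ⟨z, hz, e⟩ := hT i j y h1
    exact ⟨z, hz, zero (h2.trans e.symm)⟩
  · refine cohomologyShortExact_quotSeq _ _ _ _ (le_of_eq (inf_comm _ _)) (le_of_eq (sup_comm _ _))
      fun i j x y hx hy h => ?_
    obtain ⟨s, hs, t, ht, e⟩ := sup i j x y (Submodule.mem_sup_left h) (Submodule.mem_sup_right hx)
    -- With `dy = ds + dt`, the difference `x - dt = (x - dy) + ds` lies in `S`, and it lies in `T`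
    -- because `x` and `t` do.
    refine ⟨t, ht, ⟨?_, Submodule.sub_mem _ hx (T.d_mem i j t ht)⟩⟩
    have := Submodule.add_mem _ h (S.d_mem i j s hs)
    rw [e] at this
    rwa [sub_add_eq_sub_sub, sub_right_comm, sub_add_cancel] at this
  · refine cohomologyShortExact_quotSeq _ _ _ _ inf_le_right le_sup_left fun i j x y hx hy h => ?_
    obtain ⟨h1, h2⟩ := bot (W := S ⊓ T) h hx
    obtain ⟨z, hz, e⟩ := hinf i j y h1
    exact ⟨z, hz, zero (h2.trans e.symm)⟩
  · refine cohomologyShortExact_quotSeq _ _ _ _ inf_le_right le_sup_left fun i j x y hx hy h => ?_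
    obtain ⟨h1, h2⟩ := bot (W := S) h hx
    obtain ⟨z, hz, e⟩ := hS i j y h1
    exact ⟨z, hz, zero (h2.trans e.symm)⟩
  · refine cohomologyShortExact_quotSeq _ _ _ _ le_rfl le_rfl
      fun i j x y hx hy h => ?_
    obtain ⟨s, hs, t, ht, e⟩ := sup i j x y (Submodule.mem_sup_right h) (Submodule.mem_sup_left hx)
    refine ⟨s, hs, ⟨Submodule.sub_mem _ hx (S.d_mem i j s hs), ?_⟩⟩
    have := Submodule.add_mem _ h (T.d_mem i j t ht)
    rw [e] at this
    rwa [sub_add_eq_sub_sub, sub_add_cancel] at this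

end Subcomplex

end Bifiltered

/-! ### Koszul complexes and depth sensitivity -/

namespace GaussManin

section Koszul

variable {n : ℕ} {M : Type*} [AddCommGroup M]

theorem koszulSign_mul_self (I : Finset (Fin n)) (k : Fin n) :
    koszulSign I k * koszulSign I k = 1 := by
  rw [koszulSign, ← pow_add, ← two_mul, pow_mul, neg_one_sq, one_pow]

theorem koszulSign_anticomm (I : Finset (Fin n)) {k l : Fin n} (hk : k ∈ I) (hl : l ∈ I)
    (hkl : k ≠ l) :
    koszulSign I k * koszulSign (I.erase k) l = -(koszulSign I l * koszulSign (I.erase l) k) := by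
  rcases lt_or_gt_of_ne hkl with h | h
  · exact koszulSign_swap I hk h
  · rw [koszulSign_swap I hl h, neg_neg]

/-- The total Koszul differential of a family of endomorphisms, on families indexed by all
subsets of `Fin n`. -/
def totalD (φ : Fin n → M →+ M) : (Finset (Fin n) → M) →+ (Finset (Fin n) → M) where
  toFun c I := ∑ k ∈ I, koszulSign I k • φ k (c (I.erase k))
  map_zero' := by ext; simp
  map_add' _ _ := by ext; simp [Finset.sum_add_distrib]

theorem totalD_apply (φ : Fin n → M →+ M) (c : Finset (Fin n) → M) (I : Finset (Fin n)) :
    totalD φ c I = ∑ k ∈ I, koszulSign I k • φ k (c (I.erase k)) := rfl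

theorem totalD_totalD {φ : Fin n → M →+ M} (hφ : ∀ k l x, φ k (φ l x) = φ l (φ k x))
    (c : Finset (Fin n) → M) : totalD φ (totalD φ c) = 0 := by
  ext I
  simp only [totalD_apply, map_sum, map_zsmul, Finset.smul_sum, smul_smul, Pi.zero_apply]
  rw [Finset.sum_sigma']
  refine Finset.sum_involution (fun p _ => ⟨p.2, p.1⟩) ?_ ?_ ?_ ?_
  · rintro ⟨k, l⟩ h
    simp only [Finset.mem_sigma, Finset.mem_erase] at h
    simp only
    rw [koszulSign_anticomm I h.1 h.2.2 h.2.1.symm, hφ k l, Finset.erase_right_comm, neg_smul,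
      neg_add_cancel]
  · rintro ⟨k, l⟩ h _ e
    simp only [Finset.mem_sigma, Finset.mem_erase] at h
    exact h.2.1 (congrArg Sigma.fst e)
  · rintro ⟨k, l⟩ h
    simp only [Finset.mem_sigma, Finset.mem_erase] at h ⊢
    exact ⟨h.2.2, h.2.1.symm, h.1⟩
  · rintro ⟨k, l⟩ _
    rfl

/-- The contraction with the `k`-th coordinate vector field. -/
def contraction (k : Fin n) (c : Finset (Fin n) → M) (I : Finset (Fin n)) : M :=
  if k ∈ I then 0 else koszulSign (insert k I) k • c (insert k I)

/-- Cartan's homotopy formula. For `k ∈ I` only the `k`-th summand of the first term survives; for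
`k ∉ I` the mixed summands cancel because the signs anticommute. The `φ` need not commute. -/
theorem totalD_contraction (φ : Fin n → M →+ M) (k : Fin n) (c : Finset (Fin n) → M)
    (I : Finset (Fin n)) :
    totalD φ (contraction k c) I + contraction k (totalD φ c) I = φ k (c I) := by
  by_cases hk : k ∈ I
  · have h : contraction k (totalD φ c) I = 0 := if_pos hk
    rw [h, add_zero, totalD_apply, Finset.sum_eq_single_of_mem k hk]
    · rw [contraction, if_neg (Finset.notMem_erase k I), Finset.insert_erase hk, map_zsmul,
        smul_smul, koszulSign_mul_self, one_smul]
    · intro l _ hl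
      rw [contraction, if_pos (Finset.mem_erase.2 ⟨hl.symm, hk⟩), map_zero, smul_zero]
  · rw [contraction, if_neg hk, totalD_apply, totalD_apply, Finset.sum_insert hk,
      Finset.erase_insert hk, smul_add, smul_smul, koszulSign_mul_self, one_smul,
      add_left_comm, Finset.smul_sum, ← Finset.sum_add_distrib, Finset.sum_eq_zero, add_zero]
    intro l hl
    have hkl : k ≠ l := fun h => hk (h ▸ hl)
    have hkl' : k ∉ I.erase l := fun h => hk (Finset.mem_of_mem_erase h)
    rw [contraction, if_neg hkl', Finset.erase_insert_of_ne hkl, map_zsmul, smul_smul, smul_smul,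
      ← add_smul]
    have h1 := koszulSign_anticomm (insert k I) (Finset.mem_insert_self k I)
      (Finset.mem_insert_of_mem hl) hkl
    rw [Finset.erase_insert hk, Finset.erase_insert_of_ne hkl] at h1
    have h2 := koszulSign_mul_self (insert k I) k
    have h3 := koszulSign_mul_self (insert k (I.erase l)) k
    have h4 : koszulSign I l * koszulSign (insert k (I.erase l)) k +
        koszulSign (insert k I) k * koszulSign (insert k I) l = 0 := by
      linear_combination koszulSign (insert k I) k * koszulSign (insert k (I.erase l)) k * h1 -
        koszulSign I l * koszulSign (insert k (I.erase l)) k * h2 -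
        koszulSign (insert k I) k * koszulSign (insert k I) l * h3
    rw [h4, zero_smul]

variable {R : Type*} [CommRing R] [Module R M]

/-- The Koszul differential of a family of elements of a commutative ring. -/
def smulD (M : Type*) [AddCommGroup M] [Module R M] (f : Fin n → R) :
    (Finset (Fin n) → M) →+ (Finset (Fin n) → M) :=
  totalD fun k => DistribSMul.toAddMonoidHom M (f k)

theorem smulD_apply (f : Fin n → R) (c : Finset (Fin n) → M) (I : Finset (Fin n)) :
    smulD M f c I = ∑ k ∈ I, koszulSign I k • f k • c (I.erase k) := rfl

theorem smulD_smulD (f : Fin n → R) (c : Finset (Fin n) → M) : smulD M f (smulD M f c) = 0 :=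
  totalD_totalD (fun k l x => smul_comm (f k) (f l) x) c

theorem smulD_smul (f : Fin n → R) (r : R) (c : Finset (Fin n) → M) :
    smulD M f (r • c) = r • smulD M f c := by
  ext I
  simp only [smulD_apply, Pi.smul_apply, Finset.smul_sum]
  refine Finset.sum_congr rfl fun k _ => ?_
  rw [smul_comm (f k) r, smul_comm]

theorem smulD_comp {N : Type*} [AddCommGroup N] [Module R N] (g : M →ₗ[R] N) (f : Fin n → R)
    (c : Finset (Fin n) → M) : smulD N f (g ∘ c) = g ∘ smulD M f c := by
  ext I
  simp [smulD_apply]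

/-- Elements of the ideal generated by `f` act as zero on the cohomology of the Koszul complex. -/
theorem exists_smulD_eq_smul {f : Fin n → R} {r : R} (hr : r ∈ Ideal.span (Set.range f))
    {c : Finset (Fin n) → M} (hc : smulD M f c = 0) {m : ℕ}
    (hm : ∀ I : Finset (Fin n), m + 1 ≤ I.card → c I = 0) :
    ∃ b : Finset (Fin n) → M, smulD M f b = r • c ∧
      ∀ I : Finset (Fin n), m ≤ I.card → b I = 0 := by
  obtain ⟨a, rfl⟩ := (Ideal.mem_span_range_iff_exists_fun).1 hr
  -- For `r = ∑ a_k f_k` the primitive of `r • c` is the contraction of `c` with `∑ a_k ∂_k`, by the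
  -- homotopy formula and `dc = 0`. Contraction lowers the exterior degree by one, hence the
  -- improved vanishing range.
  refine ⟨∑ k, a k • contraction k c, ?_, fun I hI => ?_⟩
  · rw [map_sum, Finset.sum_smul]
    refine Finset.sum_congr rfl fun k _ => ?_
    rw [smulD_smul, mul_smul]
    congr 1
    ext I
    have h := totalD_contraction (fun k => DistribSMul.toAddMonoidHom M (f k)) k c I
    have h' : contraction k (smulD M f c) I = 0 := by rw [hc]; simp [contraction]
    erw [h', add_zero] at h
    exact h
  · rw [Finset.sum_apply]
    refine Finset.sum_eq_zero fun k _ => ?_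
    rw [Pi.smul_apply, contraction]
    split_ifs with h
    · rw [smul_zero]
    · rw [hm _ (by rw [Finset.card_insert_of_notMem h]; omega), smul_zero, smul_zero]

/-- Depth sensitivity of the Koszul complex: it is exact below the length of a regular sequence
of elements of the ideal. -/
theorem exists_smulD_eq {f : Fin n → R} (rs : List R) (M : Type*) [AddCommGroup M] [Module R M]
    (hrs : ∀ r ∈ rs, r ∈ Ideal.span (Set.range f)) (hreg : RingTheory.Sequence.IsWeaklyRegular M rs)
    (c : Finset (Fin n) → M) (hc : smulD M f c = 0)
    (hlen : ∀ I : Finset (Fin n), rs.length ≤ I.card → c I = 0) :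
    ∃ b : Finset (Fin n) → M, smulD M f b = c := by
  induction rs generalizing M with
  | nil => exact ⟨0, by rw [map_zero]; exact (funext fun I => hlen I (Nat.zero_le _)).symm⟩
  | cons r rs ih =>
    rw [RingTheory.Sequence.isWeaklyRegular_cons_iff] at hreg
    -- From `r c = db`, the class of `b` modulo `r` is a cycle in smaller degrees. By induction on
    -- the sequence, `b = de' + r b'`, so `r db' = r c`, and `r` cancels by regularity.
    obtain ⟨b, hb, hb'⟩ := exists_smulD_eq_smul (hrs r List.mem_cons_self) hc hlen
    let π : M →ₗ[R] QuotSMulTop r M := Submodule.mkQ _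
    have hπ : ∀ x : M, π x = 0 ↔ ∃ y, r • y = x := fun x => by
      rw [Submodule.mkQ_apply, Submodule.Quotient.mk_eq_zero,
        Submodule.mem_smul_pointwise_iff_exists]
      simp
    obtain ⟨e, he⟩ := ih (QuotSMulTop r M) (fun s hs => hrs s (List.mem_cons_of_mem _ hs)) hreg.2
      (π ∘ b) (by
        rw [smulD_comp, hb]
        ext I
        exact (hπ _).2 ⟨c I, rfl⟩)
      (fun I hI => by rw [Function.comp_apply, hb' I hI, map_zero])
    choose e' he' using fun I => Submodule.mkQ_surjective _ (e I)
    have he'' : π ∘ e' = e := funext he'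
    have hdiff : ∀ I, ∃ y, r • y = (b - smulD M f e') I := fun I => (hπ _).1 (by
      rw [Pi.sub_apply, map_sub, sub_eq_zero]
      have := congrFun (smulD_comp π f e') I
      rw [he'', he] at this
      exact this)
    choose b' hb'' using hdiff
    refine ⟨b', ?_⟩
    have h1 : r • smulD M f b' = r • c := by
      rw [← smulD_smul, show r • b' = b - smulD M f e' from funext hb'', map_sub, smulD_smulD,
        sub_zero, hb]
    exact funext fun I => hreg.1 (congrFun h1 I)

end Koszul

end GaussManin

/-! ### Convergent series: monomial division and a regular sequence -/

namespace GaussManin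

noncomputable section

variable {n : ℕ}

/-- The coefficient of a monomial in a convergent power series. -/
def coeffC (ν : Fin n →₀ ℕ) : ConvergentSeries n →ₗ[ℂ] ℂ :=
  MvPowerSeries.coeff ν ∘ₗ toSeries.toLinearMap

theorem coeffC_eq (ν : Fin n →₀ ℕ) (a : ConvergentSeries n) :
    coeffC ν a = MvPowerSeries.coeff ν (toSeries a) := rfl

theorem coeffC_ext {a b : ConvergentSeries n} (h : ∀ ν, coeffC ν a = coeffC ν b) : a = b :=
  toSeries_injective (MvPowerSeries.ext h)

open scoped Classical in
/-- The part of a convergent power series formed by the monomials satisfying a predicate. -/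
def restrict (p : (Fin n →₀ ℕ) → Prop) : ConvergentSeries n →ₗ[ℂ] ConvergentSeries n where
  toFun a := ⟨fun ν => if p ν then coeffC ν a else 0, by
    obtain ⟨r, hr, h⟩ := a.2
    refine ⟨r, hr, h.of_nonneg_of_le (fun ν => by positivity) fun ν => ?_⟩
    gcongr
    change ‖if p ν then coeffC ν a else 0‖ ≤ ‖coeffC ν a‖
    split_ifs
    · rfl
    · rw [norm_zero]; positivity⟩
  map_add' a b := coeffC_ext fun ν => by
    change (if p ν then coeffC ν (a + b) else 0) =
      (if p ν then coeffC ν a else 0) + (if p ν then coeffC ν b else 0)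
    split_ifs <;> simp
  map_smul' c a := coeffC_ext fun ν => by
    change (if p ν then coeffC ν (c • a) else 0) = c * (if p ν then coeffC ν a else 0)
    split_ifs <;> simp

open scoped Classical in
theorem coeffC_restrict (p : (Fin n →₀ ℕ) → Prop) (a : ConvergentSeries n) (ν : Fin n →₀ ℕ) :
    coeffC ν (restrict p a) = if p ν then coeffC ν a else 0 := rfl

/-- The convergent power series whose coefficient at `ν` is the one of `a` at `ν + μ`. -/
def shift (μ : Fin n →₀ ℕ) (a : ConvergentSeries n) : ConvergentSeries n :=
  ⟨fun ν => coeffC (ν + μ) a, by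
    obtain ⟨r, hr, h⟩ := a.2
    refine ⟨r, hr, ((h.comp_injective (add_left_injective μ)).mul_left
      (r ^ μ.degree)⁻¹).congr fun ν => ?_⟩
    simp only [Function.comp_apply, map_add, pow_add]
    change _ = ‖coeffC (ν + μ) a‖ * r ^ ν.degree
    rw [coeffC_eq]
    change (r ^ μ.degree)⁻¹ * (‖coeffC (ν + μ) a‖ * (r ^ ν.degree * r ^ μ.degree)) =
      ‖coeffC (ν + μ) a‖ * r ^ ν.degree
    field_simp⟩

theorem coeffC_shift (μ : Fin n →₀ ℕ) (a : ConvergentSeries n) (ν : Fin n →₀ ℕ) :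
    coeffC ν (shift μ a) = coeffC (ν + μ) a := rfl

/-- Polynomials as convergent power series. -/
def ofPoly : MvPolynomial (Fin n) ℂ →ₐ[ℂ] ConvergentSeries n :=
  (MvPolynomial.coeToMvPowerSeries.algHom ℂ).codRestrict (convergentSubalgebra n) fun p =>
    IsConvergent.of_finite ((p.support.finite_toSet).subset fun ν hν => by
      simpa using hν)

theorem toSeries_ofPoly (p : MvPolynomial (Fin n) ℂ) :
    toSeries (ofPoly p) = (p : MvPowerSeries (Fin n) ℂ) := by
  change MvPolynomial.coeToMvPowerSeries.algHom ℂ p = _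
  simp

theorem coeffC_ofPoly (p : MvPolynomial (Fin n) ℂ) (ν : Fin n →₀ ℕ) :
    coeffC ν (ofPoly p) = MvPolynomial.coeff ν p := by
  rw [coeffC_eq, toSeries_ofPoly, MvPolynomial.coeff_coe]

theorem partialDeriv_ofPoly (k : Fin n) (p : MvPolynomial (Fin n) ℂ) :
    partialDeriv k (ofPoly p) = ofPoly (MvPolynomial.pderiv k p) := by
  refine coeffC_ext fun ν => ?_
  rw [coeffC_ofPoly, coeffC_eq, toSeries_partialDeriv, MvPowerSeries.coeff_pderiv,
    ← coeffC_eq, coeffC_ofPoly, MvPolynomial.coeff_pderiv]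

/-- The coordinate functions. -/
def varX (k : Fin n) : ConvergentSeries n := ofPoly (MvPolynomial.X k)

theorem toSeries_varX_pow (k : Fin n) (N : ℕ) :
    toSeries (varX k ^ N) = MvPowerSeries.monomial (Finsupp.single k N) 1 := by
  rw [map_pow, varX, toSeries_ofPoly, MvPolynomial.coe_X, MvPowerSeries.X_pow_eq]

theorem coeffC_varX_pow_mul (k : Fin n) (N : ℕ) (a : ConvergentSeries n) (ν : Fin n →₀ ℕ) :
    coeffC ν (varX k ^ N * a) = if N ≤ ν k then coeffC (ν - Finsupp.single k N) a else 0 := by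
  rw [coeffC_eq, map_mul, toSeries_varX_pow, MvPowerSeries.coeff_monomial_mul]
  simp only [Finsupp.single_le_iff, one_mul, coeffC_eq]

theorem coeffC_mul_ne_zero {a b : ConvergentSeries n} {ν : Fin n →₀ ℕ} (h : coeffC ν (a * b) ≠ 0) :
    ∃ μ μ', μ + μ' = ν ∧ coeffC μ a ≠ 0 ∧ coeffC μ' b ≠ 0 := by
  classical
  rw [coeffC_eq, map_mul, MvPowerSeries.coeff_mul] at h
  obtain ⟨p, hp, hp0⟩ := Finset.exists_ne_zero_of_sum_ne_zero h
  exact ⟨p.1, p.2, Finset.HasAntidiagonal.mem_antidiagonal.1 hp, left_ne_zero_of_mul hp0,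
    right_ne_zero_of_mul hp0⟩

theorem eq_varX_pow_mul_shift {k : Fin n} {N : ℕ} {a : ConvergentSeries n}
    (h : ∀ ν, coeffC ν a ≠ 0 → N ≤ ν k) : a = varX k ^ N * shift (Finsupp.single k N) a := by
  refine coeffC_ext fun ν => ?_
  rw [coeffC_varX_pow_mul]
  split_ifs with hν
  · rw [coeffC_shift, tsub_add_cancel_of_le (Finsupp.single_le_iff.2 hν)]
  · by_contra h0
    exact hν (h ν h0)

/-- Division with respect to powers of coordinates: if every monomial of `a` is divisible by
one of the `xₖ^N` with `k ∈ s`, then `a` is a combination of them. -/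
theorem exists_sum_varX_pow_mul (N : ℕ) (s : Finset (Fin n)) (a : ConvergentSeries n)
    (h : ∀ ν, coeffC ν a ≠ 0 → ∃ k ∈ s, N ≤ ν k) :
    ∃ b : Fin n → ConvergentSeries n, a = ∑ k ∈ s, varX k ^ N * b k ∧
      ∀ k ν, coeffC ν (b k) ≠ 0 → coeffC (ν + Finsupp.single k N) a ≠ 0 := by
  induction s using Finset.induction_on generalizing a with
  | empty =>
    refine ⟨0, ?_, fun k ν hν => absurd (map_zero _) hν⟩
    rw [Finset.sum_empty]
    refine coeffC_ext fun ν => ?_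
    by_contra h0
    rw [map_zero] at h0
    obtain ⟨k, hk, _⟩ := h ν h0
    exact absurd hk (Finset.notMem_empty k)
  | insert k s hk ih =>
    -- The monomials divisible by `xₖ^N` are split off and assigned to the index `k`; the others are
    -- handled by the remaining indices. No monomial is used twice, so each quotient's monomials
    -- come from monomials of `a`.
    obtain ⟨b, hb, hb'⟩ := ih (restrict (fun ν => ν k < N) a) fun ν hν => by
      rw [coeffC_restrict] at hν
      split_ifs at hν with h1
      · obtain ⟨l, hl, hl'⟩ := h ν hν
        rcases Finset.mem_insert.1 hl with rfl | hl
        · omega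
        · exact ⟨l, hl, hl'⟩
      · exact absurd rfl hν
    have h2 : ∀ ν, coeffC ν (restrict (fun ν => N ≤ ν k) a) ≠ 0 → N ≤ ν k := fun ν hν => by
      by_contra h1
      exact hν (if_neg h1)
    have restrict_ne : ∀ (p : (Fin n →₀ ℕ) → Prop) ν, coeffC ν (restrict p a) ≠ 0 →
        coeffC ν a ≠ 0 := fun p ν hν h0 => hν (by rw [coeffC_restrict, h0, ite_self])
    refine ⟨Function.update b k (shift (Finsupp.single k N) (restrict (fun ν => N ≤ ν k) a)),
      ?_, ?_⟩
    · rw [Finset.sum_insert hk, Function.update_self, ← eq_varX_pow_mul_shift h2]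
      have h3 : ∑ l ∈ s, varX l ^ N * Function.update b k
          (shift (Finsupp.single k N) (restrict (fun ν => N ≤ ν k) a)) l =
          ∑ l ∈ s, varX l ^ N * b l := Finset.sum_congr rfl fun l hl => by
        rw [Function.update_of_ne (fun e : l = k => hk (e ▸ hl))]
      rw [h3, ← hb]
      refine coeffC_ext fun ν => ?_
      rw [map_add, coeffC_restrict, coeffC_restrict]
      rcases le_or_gt N (ν k) with h4 | h4
      · rw [if_pos h4, if_neg (not_lt.2 h4), add_zero]
      · rw [if_neg (not_le.2 h4), if_pos h4, zero_add]
    · intro l ν hν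
      by_cases hl : l = k
      · subst hl
        rw [Function.update_self, coeffC_shift] at hν
        exact restrict_ne _ _ hν
      · rw [Function.update_of_ne hl] at hν
        exact restrict_ne _ _ (hb' l ν hν)

theorem mem_span_varX_pow_iff (N : ℕ) (s : Finset (Fin n)) (a : ConvergentSeries n) :
    a ∈ Ideal.span ((fun k => varX k ^ N) '' (s : Set (Fin n))) ↔
      ∀ ν, coeffC ν a ≠ 0 → ∃ k ∈ s, N ≤ ν k := by
  refine ⟨fun h => ?_, fun h => ?_⟩
  · induction h using Submodule.span_induction with
    | mem x hx =>
      obtain ⟨k, hk, rfl⟩ := hx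
      intro ν hν
      refine ⟨k, hk, ?_⟩
      by_contra h0
      refine hν ?_
      change coeffC ν (varX k ^ N) = 0
      rw [← mul_one (varX k ^ N), coeffC_varX_pow_mul, if_neg h0]
    | zero => exact fun ν hν => absurd (map_zero _) hν
    | add x y _ _ hx hy =>
      intro ν hν
      rw [map_add] at hν
      by_cases h0 : coeffC ν x = 0
      · exact hy ν fun h1 => hν (by rw [h0, h1, add_zero])
      · exact hx ν h0
    | smul a x _ hx =>
      intro ν hν
      obtain ⟨μ, μ', rfl, _, h2⟩ := coeffC_mul_ne_zero hν
      obtain ⟨k, hk, hk'⟩ := hx μ' h2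
      exact ⟨k, hk, hk'.trans (by simp)⟩
  · obtain ⟨b, hb, -⟩ := exists_sum_varX_pow_mul N s a h
    rw [hb]
    exact Ideal.sum_mem _ fun k hk => Ideal.mul_mem_right _ _
      (Ideal.subset_span ⟨k, hk, rfl⟩)

/-- Equal powers of the coordinates form a regular sequence. -/
theorem isWeaklyRegular_varX_pow (N : ℕ) : RingTheory.Sequence.IsWeaklyRegular
    (ConvergentSeries n) (List.ofFn fun k : Fin n => varX k ^ N) := by
  refine ⟨fun i hi => ?_⟩
  rw [List.length_ofFn] at hi
  rw [List.getElem_ofFn]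
  have hspan : (Ideal.ofList ((List.ofFn fun k : Fin n => varX k ^ N).take i)) =
      Ideal.span ((fun k => varX k ^ N) '' ((Finset.univ.filter fun k : Fin n => k.1 < i :
        Finset (Fin n)) : Set (Fin n))) := by
    rw [Ideal.ofList]
    congr 1
    ext x
    simp only [List.mem_take_iff_getElem, List.length_ofFn, List.getElem_ofFn, Set.mem_ofPred_eq,
      Set.mem_image, Finset.coe_filter, Finset.mem_univ, true_and]
    constructor
    · rintro ⟨j, hj, rfl⟩
      exact ⟨⟨j, by omega⟩, by simp; omega, rfl⟩
    · rintro ⟨k, hk, rfl⟩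
      exact ⟨k.1, by omega, rfl⟩
  rw [isSMulRegular_iff_right_eq_zero_of_smul]
  intro x hx
  obtain ⟨a, rfl⟩ := Submodule.Quotient.mk_surjective _ x
  rw [← Submodule.Quotient.mk_smul, Submodule.Quotient.mk_eq_zero] at hx
  rw [Submodule.Quotient.mk_eq_zero]
  simp only [smul_eq_mul, Ideal.mul_top, hspan, mem_span_varX_pow_iff] at hx ⊢
  intro ν hν
  -- Multiplication by the `i`-th power leaves the exponents of the earlier variables unchanged, so
  -- divisibility of `x_i^N a` by an earlier power passes to `a`, monomial by monomial.
  obtain ⟨k, hk, hk'⟩ := hx (ν + Finsupp.single ⟨i, hi⟩ N) (by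
    rw [coeffC_varX_pow_mul, if_pos (by simp), add_tsub_cancel_right]
    exact hν)
  refine ⟨k, hk, ?_⟩
  rw [Finset.mem_filter] at hk
  rwa [Finsupp.add_apply, Finsupp.single_eq_of_ne
    (fun e => absurd (congrArg Fin.val e) (by simp; omega)), add_zero] at hk'

end

end GaussManin

/-! ### Units and the Jacobson radical of the ring of convergent series -/

namespace GaussManin

noncomputable section

variable {n : ℕ}

/-- All monomials present have degree at least one, so shrinking the radius by a factor `ε ≤ 1`
shrinks the sum by at least that factor; `ε = 1 / (2 (S + 1))` suffices. -/
theorem exists_radius_tsum_le {a : MvPowerSeries (Fin n) ℂ} (ha : IsConvergent a)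
    (h0 : MvPowerSeries.coeff 0 a = 0) : ∃ r : ℝ, 0 < r ∧
      ∀ s : Finset (Fin n →₀ ℕ), ∑ ν ∈ s, ‖MvPowerSeries.coeff ν a‖ * r ^ ν.degree ≤ 1 / 2 := by
  obtain ⟨r, hr, ha⟩ := ha
  set S := ∑' ν : Fin n →₀ ℕ, ‖MvPowerSeries.coeff ν a‖ * r ^ ν.degree
  have hS : 0 ≤ S := tsum_nonneg fun ν => by positivity
  have hε : 1 / (2 * (S + 1)) ≤ 1 := by
    rw [div_le_one (by positivity)]
    linarith
  refine ⟨1 / (2 * (S + 1)) * r, by positivity, fun s => ?_⟩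
  calc ∑ ν ∈ s, ‖MvPowerSeries.coeff ν a‖ * (1 / (2 * (S + 1)) * r) ^ ν.degree
      ≤ ∑ ν ∈ s, 1 / (2 * (S + 1)) * (‖MvPowerSeries.coeff ν a‖ * r ^ ν.degree) := by
        refine Finset.sum_le_sum fun ν _ => ?_
        rcases eq_or_ne ν 0 with rfl | hν
        · simp [h0]
        · have h1 : (1 / (2 * (S + 1))) ^ ν.degree ≤ 1 / (2 * (S + 1)) :=
            pow_le_of_le_one (by positivity) hε ((Finsupp.degree_eq_zero_iff ν).not.2 hν)
          calc _ = (1 / (2 * (S + 1))) ^ ν.degree *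
                (‖MvPowerSeries.coeff ν a‖ * r ^ ν.degree) := by rw [mul_pow]; ring
            _ ≤ _ := by gcongr
    _ = 1 / (2 * (S + 1)) * ∑ ν ∈ s, ‖MvPowerSeries.coeff ν a‖ * r ^ ν.degree := by
        rw [Finset.mul_sum]
    _ ≤ 1 / (2 * (S + 1)) * S := by
        gcongr
        exact ha.sum_le_tsum s fun ν _ => by positivity
    _ ≤ 1 / 2 := by
        rw [div_mul_eq_mul_div, one_mul, div_le_div_iff₀ (by positivity) (by positivity)]
        linarith

/-- The inverse of a convergent power series with constant term `1` is convergent. -/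
theorem isConvergent_of_mul_eq_one {u v : MvPowerSeries (Fin n) ℂ} (hu : IsConvergent u)
    (hu1 : MvPowerSeries.coeff 0 u = 1) (huv : u * v = 1) : IsConvergent v := by
  classical
  have ha : IsConvergent (1 - u) :=
    (convergentSubalgebra n).sub_mem (convergentSubalgebra n).one_mem hu
  obtain ⟨r, hr, hle⟩ := exists_radius_tsum_le ha (by
    rw [map_sub, hu1, MvPowerSeries.coeff_zero_one, sub_self])
  set a := 1 - u with ha_def
  have hv : v = 1 + a * v := by rw [ha_def, sub_mul, huv]; ring
  set A : (Fin n →₀ ℕ) → ℝ := fun ν => ‖MvPowerSeries.coeff ν a‖ * r ^ ν.degree with hA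
  set B : (Fin n →₀ ℕ) → ℝ := fun ν => ‖MvPowerSeries.coeff ν v‖ * r ^ ν.degree with hB
  have hA0 : ∀ ν, 0 ≤ A ν := fun ν => by positivity
  have hB0 : ∀ ν, 0 ≤ B ν := fun ν => by positivity
  have step : ∀ ν, B ν ≤ (if ν = 0 then 1 else 0) +
      ∑ p ∈ Finset.HasAntidiagonal.antidiagonal ν, A p.1 * B p.2 := fun ν => by
    have h1 : ‖MvPowerSeries.coeff ν v‖ ≤ (if ν = 0 then 1 else 0) +
        ∑ p ∈ Finset.HasAntidiagonal.antidiagonal ν,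
          ‖MvPowerSeries.coeff p.1 a‖ * ‖MvPowerSeries.coeff p.2 v‖ := by
      conv_lhs => rw [hv]
      rw [map_add, MvPowerSeries.coeff_one, MvPowerSeries.coeff_mul]
      refine (norm_add_le _ _).trans (add_le_add ?_ ?_)
      · split_ifs <;> simp
      · exact (norm_sum_le _ _).trans (Finset.sum_le_sum fun p _ => (norm_mul _ _).le)
    refine (mul_le_mul_of_nonneg_right h1 (by positivity)).trans (le_of_eq ?_)
    rw [add_mul, Finset.sum_mul]
    congr 1
    · split_ifs with h
      · simp [h]
      · simp
    · refine Finset.sum_congr rfl fun p hp => ?_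
      rw [← Finset.HasAntidiagonal.mem_antidiagonal.1 hp, map_add, pow_add]
      simp only [hA, hB]
      ring
  -- From `v = 1 + a v`, the sum `Σ` over a finite box satisfies `Σ ≤ 1 + Σ / 2`: the box is closed
  -- downwards, so the convolution stays in its square. As `Σ` is finite, `Σ ≤ 2` uniformly in the
  -- box.
  have bound : ∀ μ : Fin n →₀ ℕ, ∑ ν ∈ Finset.Iic μ, B ν ≤ 2 := fun μ => by
    have h1 : ∑ ν ∈ Finset.Iic μ, B ν ≤ 1 +
        ∑ ν ∈ Finset.Iic μ, ∑ p ∈ Finset.HasAntidiagonal.antidiagonal ν, A p.1 * B p.2 := by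
      refine (Finset.sum_le_sum fun ν _ => step ν).trans ?_
      rw [Finset.sum_add_distrib]
      gcongr
      rw [Finset.sum_ite_eq']
      split_ifs <;> norm_num
    have h2 : ∑ ν ∈ Finset.Iic μ, ∑ p ∈ Finset.HasAntidiagonal.antidiagonal ν, A p.1 * B p.2 ≤
        ∑ p ∈ Finset.Iic μ ×ˢ Finset.Iic μ, A p.1 * B p.2 := by
      rw [← Finset.sum_biUnion fun ν _ ν' _ hne => Finset.disjoint_left.2 fun p hp hp' => hne
        ((Finset.HasAntidiagonal.mem_antidiagonal.1 hp).symm.trans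
          (Finset.HasAntidiagonal.mem_antidiagonal.1 hp'))]
      refine Finset.sum_le_sum_of_subset_of_nonneg (fun p hp => ?_)
        fun p _ _ => mul_nonneg (hA0 _) (hB0 _)
      obtain ⟨ν, hν, hp⟩ := Finset.mem_biUnion.1 hp
      rw [Finset.mem_Iic, ← Finset.HasAntidiagonal.mem_antidiagonal.1 hp] at hν
      exact Finset.mem_product.2 ⟨Finset.mem_Iic.2 (le_self_add.trans hν),
        Finset.mem_Iic.2 (le_add_self.trans hν)⟩
    have h3 : ∑ p ∈ Finset.Iic μ ×ˢ Finset.Iic μ, A p.1 * B p.2 ≤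
        1 / 2 * ∑ ν ∈ Finset.Iic μ, B ν := by
      rw [Finset.sum_product, ← Finset.sum_mul_sum]
      exact mul_le_mul_of_nonneg_right (hle _) (Finset.sum_nonneg fun ν _ => hB0 ν)
    linarith
  refine ⟨r, hr, summable_of_sum_le hB0 (c := 2) fun s => ?_⟩
  obtain ⟨μ, hμ⟩ := s.exists_le
  exact (Finset.sum_le_sum_of_subset_of_nonneg (fun ν hν => Finset.mem_Iic.2 (hμ ν hν))
    fun ν _ _ => hB0 ν).trans (bound μ)

theorem isUnit_of_coeffC_zero {u : ConvergentSeries n} (hu : coeffC 0 u = 1) : IsUnit u := by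
  have h1 : MvPowerSeries.constantCoeff (toSeries u) ≠ 0 := by
    rw [← MvPowerSeries.coeff_zero_eq_constantCoeff_apply]
    exact hu ▸ one_ne_zero
  have h2 := MvPowerSeries.mul_inv_cancel (toSeries u) h1
  let v : ConvergentSeries n := ⟨(toSeries u)⁻¹, isConvergent_of_mul_eq_one u.2 hu h2⟩
  exact IsUnit.of_mul_eq_one v (toSeries_injective ((map_mul _ _ _).trans (h2.trans (map_one _).symm)))

/-- This is the hypothesis of Nakayama's lemma: for `a` in the ideal, `a y + 1` has constant term
`1` and is a unit. -/
theorem span_varX_le_jacobson :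
    Ideal.span (Set.range (varX : Fin n → ConvergentSeries n)) ≤ Ideal.jacobson ⊥ := by
  intro a ha
  rw [Ideal.mem_jacobson_bot]
  intro y
  refine isUnit_of_coeffC_zero ?_
  have h1 : a * y ∈ Ideal.span ((fun k : Fin n => varX k ^ 1) '' (Finset.univ : Finset (Fin n))) := by
    simpa using Ideal.mul_mem_right y _ ha
  rw [mem_span_varX_pow_iff] at h1
  have h2 : coeffC 0 (a * y) = 0 := by
    by_contra h
    obtain ⟨k, _, hk⟩ := h1 0 h
    simp at hk
  rw [map_add, h2, zero_add]
  exact MvPowerSeries.coeff_zero_one (σ := Fin n) (R := ℂ)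

end

end GaussManin

/-! ### Weights and the Jacobian ideal -/

namespace GaussManin

noncomputable section

variable {n : ℕ}

/-- The weight of a monomial for a system of integral weights. -/
def wt (W : Fin n → ℕ) (ν : Fin n →₀ ℕ) : ℕ := ∑ i, W i * ν i

theorem wt_add (W : Fin n → ℕ) (ν μ : Fin n →₀ ℕ) : wt W (ν + μ) = wt W ν + wt W μ := by
  simp [wt, mul_add, Finset.sum_add_distrib]

theorem wt_single (W : Fin n → ℕ) (k : Fin n) (N : ℕ) : wt W (Finsupp.single k N) = W k * N := by
  classical
  simp [wt, Finsupp.single_apply]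

/-- The convergent power series all of whose monomials have weight at least `s`. -/
def orderGE (W : Fin n → ℕ) (s : ℤ) : Submodule ℂ (ConvergentSeries n) where
  carrier := {a | ∀ ν, coeffC ν a ≠ 0 → s ≤ wt W ν}
  zero_mem' ν h := absurd (map_zero _) h
  add_mem' {a b} ha hb ν h := by
    by_cases h0 : coeffC ν a = 0
    · exact hb ν fun h1 => h (by rw [map_add, h0, h1, add_zero])
    · exact ha ν h0
  smul_mem' c a ha ν h := ha ν fun h' => h (by rw [map_smul, h', smul_zero])

variable {W : Fin n → ℕ}

theorem orderGE_anti {s t : ℤ} (h : s ≤ t) {a : ConvergentSeries n} (ha : a ∈ orderGE W t) :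
    a ∈ orderGE W s := fun ν hν => h.trans (ha ν hν)

theorem mul_mem_orderGE {s t : ℤ} {a b : ConvergentSeries n} (ha : a ∈ orderGE W s)
    (hb : b ∈ orderGE W t) : a * b ∈ orderGE W (s + t) := by
  intro ν hν
  obtain ⟨μ, μ', rfl, h1, h2⟩ := coeffC_mul_ne_zero hν
  rw [wt_add]
  push_cast
  exact add_le_add (ha μ h1) (hb μ' h2)

theorem coeffC_partialDeriv (k : Fin n) (a : ConvergentSeries n) (ν : Fin n →₀ ℕ) :
    coeffC ν (partialDeriv k a) = coeffC (ν + Finsupp.single k 1) a * (ν k + 1) := by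
  rw [coeffC_eq, toSeries_partialDeriv, MvPowerSeries.coeff_pderiv, coeffC_eq]

theorem partialDeriv_mem_orderGE {s : ℤ} {a : ConvergentSeries n} (ha : a ∈ orderGE W s)
    (k : Fin n) : partialDeriv k a ∈ orderGE W (s - W k) := by
  intro ν hν
  rw [coeffC_partialDeriv] at hν
  have h := ha _ (left_ne_zero_of_mul hν)
  rw [wt_add, wt_single] at h
  push_cast at h
  linarith

variable (W) in
/-- The weighted homogeneous part of weight `s`. -/
def hpart (s : ℤ) : ConvergentSeries n →ₗ[ℂ] ConvergentSeries n :=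
  restrict fun ν => (wt W ν : ℤ) = s

theorem coeffC_hpart (s : ℤ) (a : ConvergentSeries n) (ν : Fin n →₀ ℕ) :
    coeffC ν (hpart W s a) = if (wt W ν : ℤ) = s then coeffC ν a else 0 := by
  rw [hpart, coeffC_restrict]
  congr

variable (W) in
/-- `a` is weighted homogeneous of weight `s`. -/
def IsHomog (s : ℤ) (a : ConvergentSeries n) : Prop := ∀ ν, coeffC ν a ≠ 0 → (wt W ν : ℤ) = s

theorem IsHomog.mem_orderGE {s : ℤ} {a : ConvergentSeries n} (h : IsHomog W s a) :
    a ∈ orderGE W s := fun ν hν => (h ν hν).ge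

theorem isHomog_hpart (s : ℤ) (a : ConvergentSeries n) : IsHomog W s (hpart W s a) := by
  intro ν hν
  by_contra h
  exact hν (by rw [coeffC_hpart, if_neg h])

theorem IsHomog.hpart_eq {s : ℤ} {a : ConvergentSeries n} (h : IsHomog W s a) :
    hpart W s a = a := by
  refine coeffC_ext fun ν => ?_
  rw [coeffC_hpart]
  split_ifs with h1
  · rfl
  · by_contra h2
    exact h1 (h ν (Ne.symm h2))

theorem IsHomog.partialDeriv {s : ℤ} {a : ConvergentSeries n} (h : IsHomog W s a) (k : Fin n) :
    IsHomog W (s - W k) (partialDeriv k a) := by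
  intro ν hν
  rw [coeffC_partialDeriv] at hν
  have h := h _ (left_ne_zero_of_mul hν)
  rw [wt_add, wt_single] at h
  push_cast at h
  linarith

theorem hpart_eq_zero {s : ℤ} {a : ConvergentSeries n} (h : a ∈ orderGE W (s + 1)) :
    hpart W s a = 0 := by
  refine coeffC_ext fun ν => ?_
  rw [coeffC_hpart, map_zero]
  split_ifs with h1
  · by_contra h2
    have := h ν h2
    omega
  · rfl

theorem sub_hpart_mem {s : ℤ} {a : ConvergentSeries n} (h : a ∈ orderGE W s) :
    a - hpart W s a ∈ orderGE W (s + 1) := by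
  intro ν hν
  rw [map_sub, coeffC_hpart] at hν
  split_ifs at hν with h1
  · exact absurd (sub_self _) hν
  · rw [sub_zero] at hν
    have := h ν hν
    omega

theorem coeffC_mul (a b : ConvergentSeries n) (ν : Fin n →₀ ℕ) :
    coeffC ν (a * b) = ∑ p ∈ Finset.HasAntidiagonal.antidiagonal ν,
      coeffC p.1 a * coeffC p.2 b := by
  classical
  rw [coeffC_eq, map_mul toSeries, MvPowerSeries.coeff_mul]
  convert rfl <;> rfl

theorem hpart_mul {s t : ℤ} (c : ConvergentSeries n) {g : ConvergentSeries n} (hg : IsHomog W t g) :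
    hpart W (s + t) (g * c) = g * hpart W s c := by
  refine coeffC_ext fun ν => ?_
  have key : ∀ p ∈ Finset.HasAntidiagonal.antidiagonal ν, coeffC p.1 g * coeffC p.2 (hpart W s c) =
      if (wt W ν : ℤ) = s + t then coeffC p.1 g * coeffC p.2 c else 0 := fun p hp => by
    by_cases h : coeffC p.1 g = 0
    · simp [h]
    · have h1 := hg _ h
      have h2 : ((wt W p.2 : ℤ) = s) ↔ (wt W ν : ℤ) = s + t := by
        rw [← Finset.HasAntidiagonal.mem_antidiagonal.1 hp, wt_add]
        push_cast
        omega
      rw [coeffC_hpart, mul_ite, mul_zero]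
      exact if_congr h2 rfl rfl
  rw [coeffC_hpart, coeffC_mul, coeffC_mul, Finset.sum_congr rfl key]
  split_ifs <;> simp

theorem isHomog_varX_pow (k : Fin n) (N : ℕ) : IsHomog W (W k * N) (varX k ^ N) := by
  classical
  intro ν hν
  rw [coeffC_eq, toSeries_varX_pow, MvPowerSeries.coeff_monomial] at hν
  split_ifs at hν with h
  · rw [h, wt_single]; push_cast; rfl
  · exact absurd rfl hν

/-- Some power of every coordinate function lies in the Jacobian ideal of a quasihomogeneous
polynomial with isolated singularity. -/
theorem exists_X_pow_mem_jacobian {g : MvPolynomial (Fin n) ℂ} {D : ℕ} (hW : ∀ i, 0 < W i)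
    (hg : ∀ ν, MvPolynomial.coeff ν g ≠ 0 → wt W ν = D)
    (hiso : ∀ᶠ z : Fin n → ℂ in nhdsWithin 0 {0}ᶜ,
      ∃ i, MvPolynomial.eval z (MvPolynomial.pderiv i g) ≠ 0) :
    ∃ N : ℕ, ∀ k, (MvPolynomial.X k : MvPolynomial (Fin n) ℂ) ^ N ∈
      Ideal.span (Set.range fun i => MvPolynomial.pderiv i g) := by
  set I := Ideal.span (Set.range fun i => MvPolynomial.pderiv i g) with hI
  -- A nonzero common zero `z` would give the common zeros `(t^(W_i) z_i)`, nonzero and tending to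
  -- the origin as `t → 0`, so the origin would not be isolated.
  have hzero : ∀ z ∈ MvPolynomial.zeroLocus ℂ I, z = 0 := by
    intro z hz
    by_contra hz0
    have hz' : ∀ i, MvPolynomial.eval z (MvPolynomial.pderiv i g) = 0 := fun i => by
      have := hz _ (Ideal.subset_span ⟨i, rfl⟩)
      rw [← MvPolynomial.coe_aeval_eq_eval]
      exact this
    let φ : ℂ → Fin n → ℂ := fun t i => t ^ W i * z i
    have hscale : ∀ t i, MvPolynomial.eval (φ t) (MvPolynomial.pderiv i g) * t ^ W i =
        t ^ D * MvPolynomial.eval z (MvPolynomial.pderiv i g) := by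
      intro t i
      rw [MvPolynomial.eval_eq', MvPolynomial.eval_eq', Finset.mul_sum, Finset.sum_mul]
      refine Finset.sum_congr rfl fun ν hν => ?_
      have h1 : wt W ν + W i = D := by
        rw [MvPolynomial.mem_support_iff, MvPolynomial.coeff_pderiv] at hν
        have := hg _ (left_ne_zero_of_mul hν)
        rwa [wt_add, wt_single, mul_one] at this
      rw [← h1, pow_add, wt, ← Finset.prod_pow_eq_pow_sum]
      simp only [φ, mul_pow, Finset.prod_mul_distrib, pow_mul]
      ring
    have htend : Filter.Tendsto φ (nhdsWithin 0 {0}ᶜ) (nhdsWithin 0 {0}ᶜ) := by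
      rw [tendsto_nhdsWithin_iff]
      refine ⟨?_, ?_⟩
      · have hc : Continuous φ := by fun_prop
        have h0 : φ 0 = 0 := by
          ext i
          simp [φ, (hW i).ne']
        exact (h0 ▸ hc.tendsto 0).mono_left nhdsWithin_le_nhds
      · filter_upwards [self_mem_nhdsWithin] with t ht h0
        refine hz0 (funext fun i => ?_)
        exact (mul_eq_zero.1 (congrFun h0 i)).resolve_left (pow_ne_zero _ ht)
    obtain ⟨t, ⟨i, hi⟩, ht⟩ := ((htend.eventually hiso).and self_mem_nhdsWithin).exists
    have h2 := hscale t i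
    rw [hz' i, mul_zero] at h2
    exact hi ((mul_eq_zero.1 h2).resolve_right (pow_ne_zero _ ht))
  -- Hilbert's Nullstellensatz: each coordinate vanishes on the zero locus, so it lies in the
  -- radical.
  have hmem : ∀ k, ∃ N, (MvPolynomial.X k : MvPolynomial (Fin n) ℂ) ^ N ∈ I := fun k => by
    change MvPolynomial.X k ∈ I.radical
    rw [← MvPolynomial.vanishingIdeal_zeroLocus_eq_radical (K := ℂ), MvPolynomial.mem_vanishingIdeal_iff]
    intro z hz
    rw [hzero z hz]
    simp
  choose N hN using hmem
  refine ⟨∑ k, N k, fun k => ?_⟩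
  exact I.pow_mem_of_pow_mem (hN k) (Finset.single_le_sum (fun _ _ => Nat.zero_le _)
    (Finset.mem_univ k))

variable {f g : ConvergentSeries n} {D : ℕ}

/-- The Jacobian ideal of `g` contains a power of every coordinate function. -/
def FiniteJacobian (g : ConvergentSeries n) : Prop :=
  ∃ N : ℕ, ∀ k, varX k ^ N ∈ Ideal.span (Set.range fun i => partialDeriv i g)

theorem finiteJacobian_ofPoly {g : MvPolynomial (Fin n) ℂ} (hW : ∀ i, 0 < W i)
    (hg : ∀ ν, MvPolynomial.coeff ν g ≠ 0 → wt W ν = D)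
    (hiso : ∀ᶠ z : Fin n → ℂ in nhdsWithin 0 {0}ᶜ,
      ∃ i, MvPolynomial.eval z (MvPolynomial.pderiv i g) ≠ 0) : FiniteJacobian (ofPoly g) := by
  obtain ⟨N, hN⟩ := exists_X_pow_mem_jacobian hW hg hiso
  refine ⟨N, fun k => ?_⟩
  have h := Ideal.mem_map_of_mem ofPoly (hN k)
  rw [Ideal.map_span, ← Set.range_comp] at h
  rw [varX, ← map_pow]
  convert h using 4 with i
  exact partialDeriv_ofPoly i g

/-- One step of the approximation of a series of large weight by elements of the Jacobian
ideal of a perturbation of `g` by terms of higher weight. -/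
theorem exists_sub_mem_orderGE (hg : IsHomog W D g) (hfg : f - g ∈ orderGE W (D + 1)) {N : ℕ}
    (hN : ∀ k, varX k ^ N ∈ Ideal.span (Set.range fun i => partialDeriv i g))
    (hn : 0 < n) (hW : ∀ i, 0 < W i) {M : ℤ} (hM : (∑ k, W k * N : ℕ) ≤ M)
    {a : ConvergentSeries n} (ha : a ∈ orderGE W M) :
    ∃ i ∈ Ideal.span (Set.range fun i => partialDeriv i f), a - i ∈ orderGE W (M + 1) := by
  -- If all exponents were below `N`, the weight would be less than `∑ W_k N`, strictly because `n >
  -- 0`.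
  have hdiv : ∀ ν, coeffC ν a ≠ 0 → ∃ k ∈ Finset.univ, N ≤ ν k := fun ν hν => by
    by_contra! hlt
    have h1 := ha ν hν
    have h2 : wt W ν < ∑ k, W k * N :=
      Finset.sum_lt_sum_of_nonempty ⟨⟨0, hn⟩, Finset.mem_univ _⟩ fun k hk =>
        Nat.mul_lt_mul_of_pos_left (hlt k hk) (hW k)
    omega
  obtain ⟨b, hab, hb⟩ := exists_sum_varX_pow_mul N Finset.univ a hdiv
  have hb' : ∀ k, b k ∈ orderGE W (M - W k * N) := fun k ν hν => by
    have h1 := ha _ (hb k ν hν)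
    rw [wt_add, wt_single] at h1
    push_cast at h1
    linarith
  -- Since `x_k^N` and the `∂_j g` are weighted homogeneous, the coefficients can be replaced by
  -- their parts of the complementary weight.
  have hC : ∀ k, ∃ C : Fin n → ConvergentSeries n, (∀ j, C j ∈ orderGE W (W k * N - (D - W j))) ∧
      ∑ j, partialDeriv j g * C j = varX k ^ N := fun k => by
    obtain ⟨C, hC⟩ := Ideal.mem_span_range_iff_exists_fun.1 (hN k)
    refine ⟨fun j => hpart W (W k * N - (D - W j)) (C j),
      fun j => (isHomog_hpart _ _).mem_orderGE, ?_⟩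
    rw [← (isHomog_varX_pow (W := W) k N).hpart_eq, ← hC, map_sum]
    refine Finset.sum_congr rfl fun j _ => ?_
    rw [← hpart_mul _ (hg.partialDeriv j), sub_add_cancel, mul_comm (C j)]
  choose C hC hC' using hC
  refine ⟨∑ k, ∑ j, b k * C k j * partialDeriv j f, Ideal.sum_mem _ fun k _ =>
    Ideal.sum_mem _ fun j _ => Ideal.mul_mem_left _ _ (Ideal.subset_span ⟨j, rfl⟩), ?_⟩
  have h1 : a - ∑ k, ∑ j, b k * C k j * partialDeriv j f =
      -∑ k, ∑ j, b k * C k j * partialDeriv j (f - g) := by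
    conv_lhs => rw [hab]
    rw [← Finset.sum_neg_distrib, ← Finset.sum_sub_distrib]
    refine Finset.sum_congr rfl fun k _ => ?_
    rw [← hC' k, Finset.sum_mul, ← Finset.sum_neg_distrib, ← Finset.sum_sub_distrib]
    refine Finset.sum_congr rfl fun j _ => ?_
    rw [map_sub]
    ring
  rw [h1]
  refine Submodule.neg_mem _ (Submodule.sum_mem _ fun k _ => Submodule.sum_mem _ fun j _ => ?_)
  -- The weights add up to `(M - W_k N) + (W_k N - D + W_j) + (D + 1 - W_j) = M + 1`; the gain comes
  -- from `f - g`.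
  have h2 := mul_mem_orderGE (mul_mem_orderGE (hb' k) (hC k j)) (partialDeriv_mem_orderGE hfg j)
  exact orderGE_anti (by linarith) h2

/-- The Jacobian ideal remains of finite colength under perturbations by terms of higher
weight. -/
theorem FiniteJacobian.of_isHomog (hJ : FiniteJacobian g) (hg : IsHomog W D g)
    (hfg : f - g ∈ orderGE W (D + 1)) (hn : 0 < n) (hW : ∀ i, 0 < W i) : FiniteJacobian f := by
  obtain ⟨N, hN⟩ := hJ
  set M : ℕ := ∑ k, W k * N
  set I := Ideal.span (Set.range fun i => partialDeriv i f)
  have iter : ∀ (s : ℕ) (a : ConvergentSeries n), a ∈ orderGE W M →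
      ∃ i ∈ I, a - i ∈ orderGE W (M + s) := by
    intro s a ha
    induction s with
    | zero => exact ⟨0, I.zero_mem, by simpa using ha⟩
    | succ s ih =>
      obtain ⟨i, hi, hi'⟩ := ih
      obtain ⟨i₂, hi₂, hi₂'⟩ := exists_sub_mem_orderGE hg hfg hN hn hW (M := M + s) (by omega) hi'
      refine ⟨i + i₂, I.add_mem hi hi₂, ?_⟩
      rw [← sub_sub]
      exact orderGE_anti (by push_cast; linarith) hi₂'
  set P := Ideal.span ((fun k : Fin n => varX k ^ M) '' ((Finset.univ : Finset (Fin n)) : Set _))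
  have hP : P ≤ I ⊔ Ideal.span (Set.range (varX : Fin n → ConvergentSeries n)) • P := by
    refine Ideal.span_le.2 ?_
    rintro _ ⟨k, _, rfl⟩
    have hk : varX k ^ M ∈ orderGE W M := orderGE_anti
      (le_mul_of_one_le_left (by positivity) (by exact_mod_cast hW k))
      (isHomog_varX_pow (W := W) k M).mem_orderGE
    -- After this many steps the remainder has weight at least `∑ W_k (M + 1)`. Each of its
    -- monomials is then divisible by some `x_l^(M+1)`, which puts the remainder in the maximal
    -- ideal times `P`.
    obtain ⟨i, hi, hi'⟩ := iter (∑ k, W k * (M + 1)) _ hk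
    obtain ⟨b, hb, -⟩ := exists_sum_varX_pow_mul (M + 1) Finset.univ (varX k ^ M - i) fun ν hν => by
      by_contra! hlt
      have h1 := hi' ν hν
      have h2 : wt W ν < ∑ k, W k * (M + 1) :=
        Finset.sum_lt_sum_of_nonempty ⟨⟨0, hn⟩, Finset.mem_univ _⟩ fun k hk =>
          Nat.mul_lt_mul_of_pos_left (hlt k hk) (hW k)
      omega
    refine Submodule.mem_sup.2 ⟨i, hi, varX k ^ M - i, ?_, by ring⟩
    rw [hb]
    refine Submodule.sum_mem _ fun l _ => ?_
    rw [pow_succ', mul_assoc]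
    exact Submodule.smul_mem_smul (Ideal.subset_span ⟨l, rfl⟩)
      (Ideal.mul_mem_right _ _ (Ideal.subset_span ⟨l, Finset.mem_univ l, rfl⟩))
  have hPI : P ≤ I := Submodule.le_of_le_smul_of_le_jacobson_bot
    (Submodule.fg_span ((Finset.finite_toSet _).image _)) span_varX_le_jacobson hP
  exact ⟨M, fun k => hPI (Ideal.subset_span ⟨k, Finset.mem_univ k, rfl⟩)⟩

/-- The Koszul complex of the partial derivatives is exact below the top degree. -/
theorem FiniteJacobian.exists_smulD_eq (hJ : FiniteJacobian g)
    (c : Finset (Fin n) → ConvergentSeries n)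
    (hc : smulD (ConvergentSeries n) (fun i => partialDeriv i g) c = 0)
    (hcard : ∀ I : Finset (Fin n), n ≤ I.card → c I = 0) :
    ∃ b, smulD (ConvergentSeries n) (fun i => partialDeriv i g) b = c := by
  obtain ⟨N, hN⟩ := hJ
  refine GaussManin.exists_smulD_eq _ _ (fun r hr => ?_) (isWeaklyRegular_varX_pow N) c hc
    (by simpa using hcard)
  obtain ⟨k, rfl⟩ := (List.mem_ofFn' _ _).1 hr
  exact hN k

/-! ### Weighted exactness of the Koszul complex -/

variable (W D) in
/-- The weight of `dx_I`, normalized so that exterior multiplication with the differential of a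
series of weight `D` preserves the weight. -/
def formWt (I : Finset (Fin n)) : ℤ := ∑ k ∈ I, ((D : ℤ) - W k)

theorem formWt_erase {I : Finset (Fin n)} {k : Fin n} (hk : k ∈ I) :
    formWt W D (I.erase k) + (D - W k) = formWt W D I :=
  Finset.sum_erase_add _ _ hk

/-- Needed for `f - g` with `t = 1`: replacing `df ∧` by `dg ∧` costs only terms of order one
higher. -/
theorem smulD_mem_orderGE {t s : ℤ} (hf : f ∈ orderGE W (D + t))
    {c : Finset (Fin n) → ConvergentSeries n} (hc : ∀ I, c I ∈ orderGE W (s + formWt W D I))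
    (I : Finset (Fin n)) :
    smulD (ConvergentSeries n) (fun i => partialDeriv i f) c I ∈
      orderGE W (s + t + formWt W D I) := by
  rw [smulD_apply]
  refine Submodule.sum_mem _ fun k hk => zsmul_mem ?_ _
  have h := mul_mem_orderGE (partialDeriv_mem_orderGE hf k) (hc (I.erase k))
  rw [smul_eq_mul]
  exact orderGE_anti (by rw [← formWt_erase hk]; linarith) h

theorem smulD_hpart (hg : IsHomog W D g) (s : ℤ) (c : Finset (Fin n) → ConvergentSeries n) :
    smulD (ConvergentSeries n) (fun i => partialDeriv i g)
        (fun I => hpart W (s + formWt W D I) (c I)) =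
      fun I => hpart W (s + formWt W D I)
        (smulD (ConvergentSeries n) (fun i => partialDeriv i g) c I) := by
  ext1 I
  rw [smulD_apply, smulD_apply, map_sum]
  refine Finset.sum_congr rfl fun k hk => ?_
  rw [map_zsmul, ← formWt_erase hk, ← add_assoc, smul_eq_mul, smul_eq_mul,
    hpart_mul _ (hg.partialDeriv k)]

theorem smulD_sub_apply (c : Finset (Fin n) → ConvergentSeries n) (I : Finset (Fin n)) :
    smulD (ConvergentSeries n) (fun i => partialDeriv i (f - g)) c I =
      smulD (ConvergentSeries n) (fun i => partialDeriv i f) c I -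
      smulD (ConvergentSeries n) (fun i => partialDeriv i g) c I := by
  simp only [smulD_apply, map_sub, sub_smul, smul_sub, Finset.sum_sub_distrib]

/-- Exactness of the Koszul complex on the graded pieces for the weight filtration. -/
theorem exists_sub_smulD_mem_orderGE (hJ : FiniteJacobian g) (hg : IsHomog W D g)
    (hfg : f - g ∈ orderGE W (D + 1)) {s : ℤ} {c : Finset (Fin n) → ConvergentSeries n}
    (hcard : ∀ I : Finset (Fin n), n ≤ I.card → c I = 0)
    (hc : ∀ I, c I ∈ orderGE W (s + formWt W D I))
    (hd : ∀ I, smulD (ConvergentSeries n) (fun i => partialDeriv i f) c I ∈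
      orderGE W (s + 1 + formWt W D I)) :
    ∃ b : Finset (Fin n) → ConvergentSeries n, (∀ I, b I ∈ orderGE W (s + formWt W D I)) ∧
      ∀ I, c I - smulD (ConvergentSeries n) (fun i => partialDeriv i f) b I ∈
        orderGE W (s + 1 + formWt W D I) := by
  -- The leading part of `c` is a cycle for `dg ∧`: `df ∧ c` has higher order, and so does its
  -- difference from `dg ∧ c`.
  have h0 : smulD (ConvergentSeries n) (fun i => partialDeriv i g)
      (fun I => hpart W (s + formWt W D I) (c I)) = 0 := by
    rw [smulD_hpart hg]
    ext1 I
    refine hpart_eq_zero ?_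
    have h := Submodule.sub_mem _ (hd I) (smulD_mem_orderGE hfg hc I)
    rw [smulD_sub_apply, sub_sub_cancel] at h
    exact orderGE_anti (by linarith) h
  obtain ⟨b, hb⟩ := hJ.exists_smulD_eq _ h0 fun I hI => by rw [hcard I hI, map_zero]
  have hb0 : ∀ I, hpart W (s + formWt W D I) (b I) ∈ orderGE W (s + formWt W D I) :=
    fun I => (isHomog_hpart _ _).mem_orderGE
  refine ⟨fun I => hpart W (s + formWt W D I) (b I), hb0, fun I => ?_⟩
  have h1 : smulD (ConvergentSeries n) (fun i => partialDeriv i g)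
      (fun I => hpart W (s + formWt W D I) (b I)) I = hpart W (s + formWt W D I) (c I) := by
    rw [smulD_hpart hg, hb]
    exact (isHomog_hpart _ _).hpart_eq
  have h2 := Submodule.sub_mem _ (orderGE_anti (t := s + formWt W D I + 1)
    (s := s + 1 + formWt W D I) (by linarith) (sub_hpart_mem (hc I)))
    (smulD_mem_orderGE hfg hb0 I)
  rw [smulD_sub_apply, h1, sub_sub, add_sub_cancel] at h2
  exact h2

end

end GaussManin

/-! ### Levels of the Gauss–Manin complex and correction by boundaries -/

namespace GaussManin

noncomputable section

variable {n : ℕ}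

section Total

variable {M : Type*} [AddCommGroup M]

theorem totalD_apply_of_card_ne {φ : Fin n → M →+ M} {c : Finset (Fin n) → M} {j : ℕ}
    (hc : ∀ I, I.card ≠ j → c I = 0) {I : Finset (Fin n)} (hI : I.card ≠ j + 1) :
    totalD φ c I = 0 := by
  rw [totalD_apply]
  refine Finset.sum_eq_zero fun k hk => ?_
  have h := Finset.card_erase_add_one hk
  rw [hc _ (by omega), map_zero, smul_zero]

theorem totalD_eq_of_card {φ : Fin n → M →+ M} {b b' : Finset (Fin n) → M} {I : Finset (Fin n)}
    (h : ∀ J : Finset (Fin n), J.card + 1 = I.card → b J = b' J) :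
    totalD φ b I = totalD φ b' I := by
  rw [totalD_apply, totalD_apply]
  refine Finset.sum_congr rfl fun k hk => ?_
  rw [h _ (Finset.card_erase_add_one hk)]

end Total

/-- The differential of `K_f` on families indexed by all subsets. -/
def gmD (f : ConvergentSeries n) : (Finset (Fin n) → Micro n) →+ (Finset (Fin n) → Micro n) :=
  totalD fun k => (microD f k).toAddMonoidHom

/-- The exterior derivative. -/
def deRhamD : (Finset (Fin n) → ConvergentSeries n) →+ (Finset (Fin n) → ConvergentSeries n) :=
  totalD fun k => (partialDeriv k).toAddMonoidHom

theorem deRhamD_apply (c : Finset (Fin n) → ConvergentSeries n) (I : Finset (Fin n)) :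
    deRhamD c I = ∑ k ∈ I, koszulSign I k • partialDeriv k (c (I.erase k)) := rfl

/-- Exterior multiplication with `df`. -/
abbrev wedgeD (f : ConvergentSeries n) :
    (Finset (Fin n) → ConvergentSeries n) →+ (Finset (Fin n) → ConvergentSeries n) :=
  smulD (ConvergentSeries n) fun i => partialDeriv i f

/-- The coefficients of `dx_I ⊗ ∂ₜ^(q + |I|)`. -/
def comp (x : Finset (Fin n) → Micro n) (q : ℤ) (I : Finset (Fin n)) : ConvergentSeries n :=
  x I (q + I.card)

theorem comp_add (x y : Finset (Fin n) → Micro n) (q : ℤ) :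
    comp (x + y) q = comp x q + comp y q := rfl

/-- The shift of the `∂ₜ`-exponent by `|I|` absorbs the exponent increase in the `df`-term, which
therefore preserves the level, while the derivative term lowers it by one. -/
theorem comp_gmD (f : ConvergentSeries n) (x : Finset (Fin n) → Micro n) (q : ℤ) :
    comp (gmD f x) q = deRhamD (comp x (q + 1)) - wedgeD f (comp x q) := by
  ext1 I
  rw [Pi.sub_apply, deRhamD_apply, smulD_apply, ← Finset.sum_sub_distrib]
  change (totalD _ x) I (q + I.card) = _
  rw [totalD_apply, Finsupp.finsetSum_apply]
  refine Finset.sum_congr rfl fun k hk => ?_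
  have h : (I.card : ℤ) = (I.erase k).card + 1 := by
    exact_mod_cast (Finset.card_erase_add_one hk).symm
  rw [Finsupp.smul_apply, ← smul_sub]
  congr 1
  change microD f k (x (I.erase k)) (q + I.card) = _
  rw [microD_apply, h, smul_eq_mul, comp, comp]
  congr 3 <;> ring_nf

/-- The element with only one homogeneous component. -/
def inj (q : ℤ) (η : Finset (Fin n) → ConvergentSeries n) (I : Finset (Fin n)) : Micro n :=
  Finsupp.single (q + I.card) (η I)

theorem comp_inj_self (q : ℤ) (η : Finset (Fin n) → ConvergentSeries n) : comp (inj q η) q = η :=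
  funext fun _ => Finsupp.single_eq_same

theorem comp_inj_of_ne {q q' : ℤ} (h : q' ≠ q) (η : Finset (Fin n) → ConvergentSeries n) :
    comp (inj q η) q' = 0 :=
  funext fun _ => Finsupp.single_eq_of_ne (by omega)

theorem gmD_gmD (f : ConvergentSeries n) (x : Finset (Fin n) → Micro n) : gmD f (gmD f x) = 0 :=
  totalD_totalD (fun k l x => microD_comm f k l x) x

/-- Adding the boundary of an element concentrated in level `q` changes only levels `q` and `q - 1`.
This allows corrections from the top level downwards. -/
theorem comp_add_gmD_inj (f : ConvergentSeries n) (x : Finset (Fin n) → Micro n) (q : ℤ)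
    (η : Finset (Fin n) → ConvergentSeries n) :
    comp (x + gmD f (inj q η)) q = comp x q - wedgeD f η := by
  rw [comp_add, comp_gmD, comp_inj_self, comp_inj_of_ne (by omega), map_zero, zero_sub,
    sub_eq_add_neg]

theorem comp_add_gmD_inj_sub_one (f : ConvergentSeries n) (x : Finset (Fin n) → Micro n) (q : ℤ)
    (η : Finset (Fin n) → ConvergentSeries n) :
    comp (x + gmD f (inj q η)) (q - 1) = comp x (q - 1) + deRhamD η := by
  rw [comp_add, comp_gmD, sub_add_cancel, comp_inj_self, comp_inj_of_ne (by omega), map_zero,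
    sub_zero]

theorem comp_add_gmD_inj_of_ne (f : ConvergentSeries n) (x : Finset (Fin n) → Micro n) {q q' : ℤ}
    (η : Finset (Fin n) → ConvergentSeries n) (h : q' ≠ q) (h' : q' ≠ q - 1) :
    comp (x + gmD f (inj q η)) q' = comp x q' := by
  rw [comp_add, comp_gmD, comp_inj_of_ne h, comp_inj_of_ne (by omega), map_zero, map_zero,
    sub_zero, add_zero]

/-- The families concentrated in one exterior degree. -/
def HasDegree {M : Type*} [Zero M] (j : ℕ) (c : Finset (Fin n) → M) : Prop :=
  ∀ I, I.card ≠ j → c I = 0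

theorem HasDegree.add_gmD_inj {f : ConvergentSeries n} {x : Finset (Fin n) → Micro n} {j : ℕ}
    (hx : HasDegree j x) (q : ℤ) {η : Finset (Fin n) → ConvergentSeries n}
    (hη : ∀ I : Finset (Fin n), I.card + 1 ≠ j → η I = 0) :
    HasDegree j (x + gmD f (inj q η)) := by
  intro I hI
  rw [Pi.add_apply, hx I hI, zero_add, gmD, totalD_apply]
  refine Finset.sum_eq_zero fun k hk => ?_
  have h := Finset.card_erase_add_one hk
  rw [inj, hη _ (by omega), Finsupp.single_zero, map_zero, smul_zero]

theorem HasDegree.comp {x : Finset (Fin n) → Micro n} {j : ℕ} (hx : HasDegree j x) (q : ℤ) :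
    HasDegree j (comp x q) := fun I hI => by
  rw [GaussManin.comp, hx I hI]
  rfl

variable {f g : ConvergentSeries n} {W : Fin n → ℕ} {D : ℕ}

open scoped Classical in
/-- The part of exterior degree `j - 1`. -/
def degreePart (j : ℕ) (b : Finset (Fin n) → ConvergentSeries n) (I : Finset (Fin n)) :
    ConvergentSeries n := if I.card + 1 = j then b I else 0

theorem wedgeD_degreePart {j : ℕ} (b : Finset (Fin n) → ConvergentSeries n) {I : Finset (Fin n)}
    (hI : I.card = j) : wedgeD f (degreePart j b) I = wedgeD f b I :=
  totalD_eq_of_card fun _ hJ => if_pos (hJ.trans hI)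

theorem wedgeD_degreePart_of_ne {j : ℕ} (b : Finset (Fin n) → ConvergentSeries n)
    {I : Finset (Fin n)} (hI : I.card ≠ j) : wedgeD f (degreePart j b) I = 0 := by
  rw [← Pi.zero_apply (M := fun _ => ConvergentSeries n) I, ← map_zero (wedgeD f)]
  exact totalD_eq_of_card fun _ hJ => if_neg fun h => hI (hJ.symm.trans h)

/-- Boundaries lying in `F_p` are boundaries of elements of `F_p`. -/
theorem exists_comp_eq_zero (hJ : FiniteJacobian f) {j : ℕ} (hj : j < n) {p : ℤ} (m : ℕ)
    (x : Finset (Fin n) → Micro n) (hx : HasDegree j x) (hm : ∀ q, p + m < q → comp x q = 0)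
    (hd : ∀ q, p < q → comp (gmD f x) q = 0) :
    ∃ x', HasDegree j x' ∧ gmD f x' = gmD f x ∧ ∀ q, p < q → comp x' q = 0 := by
  induction m generalizing x with
  | zero => exact ⟨x, hx, rfl, fun q hq => hm q (by simpa using hq)⟩
  | succ m ih =>
    push_cast at hm
    -- In the highest possibly nonzero level nothing arrives from above, so the boundary there is
    -- `-df ∧` of the component, which vanishes by `hd`.
    have h0 : wedgeD f (comp x (p + (m + 1))) = 0 := by
      have h := hd (p + (m + 1)) (by omega)
      rw [comp_gmD, hm _ (by omega), map_zero, zero_sub, neg_eq_zero] at h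
      exact h
    obtain ⟨b, hb⟩ := hJ.exists_smulD_eq _ h0 fun I hI => hx.comp _ I (by omega)
    have hb' : wedgeD f (degreePart j b) = comp x (p + (m + 1)) := by
      ext1 I
      by_cases hI : I.card = j
      · rw [wedgeD_degreePart b hI, hb]
      · rw [wedgeD_degreePart_of_ne b hI, hx.comp _ I hI]
    obtain ⟨x', hx', hxd, hxp⟩ := ih (x + gmD f (inj (p + (m + 1)) (degreePart j b)))
      (hx.add_gmD_inj _ fun I hI => if_neg hI) (fun q hq => by
        rcases eq_or_ne q (p + (m + 1)) with rfl | hq'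
        · rw [comp_add_gmD_inj, hb', sub_self]
        · rw [comp_add_gmD_inj_of_ne _ _ _ hq' (by omega), hm _ (by omega)])
      (by rwa [map_add, gmD_gmD, add_zero])
    exact ⟨x', hx', by rw [hxd, map_add, gmD_gmD, add_zero], hxp⟩

variable (W D) in
/-- The weight filtration on differential forms. -/
def formGE (s : ℤ) : AddSubgroup (Finset (Fin n) → ConvergentSeries n) where
  carrier := {c | ∀ I, c I ∈ orderGE W (s + formWt W D I)}
  zero_mem' _ := Submodule.zero_mem _
  add_mem' hb hc I := Submodule.add_mem _ (hb I) (hc I)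
  neg_mem' hc I := Submodule.neg_mem _ (hc I)

theorem formGE_anti {s t : ℤ} (h : s ≤ t) {c : Finset (Fin n) → ConvergentSeries n}
    (hc : c ∈ formGE W D t) : c ∈ formGE W D s :=
  fun I => orderGE_anti (by linarith) (hc I)

/-- The loss of `D` equals the drop of the bound `t + q D` when the level drops by one, so such
bounds are compatible with the whole differential. -/
theorem deRhamD_mem_formGE {s : ℤ} {c : Finset (Fin n) → ConvergentSeries n}
    (hc : c ∈ formGE W D s) : deRhamD c ∈ formGE W D (s - D) := by
  intro I
  rw [deRhamD_apply]
  refine Submodule.sum_mem _ fun k hk => zsmul_mem ?_ _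
  exact orderGE_anti (by rw [← formWt_erase hk]; linarith)
    (partialDeriv_mem_orderGE (hc (I.erase k)) k)

/-- Weights of monomials are nonnegative and the `dx_I` have finitely many weights, so a
sufficiently negative order imposes no condition. -/
theorem exists_forall_mem_formGE : ∃ B : ℤ, ∀ (s : ℤ) (c : Finset (Fin n) → ConvergentSeries n),
    s ≤ B → c ∈ formGE W D s := by
  obtain ⟨B, hB⟩ := (Finset.univ.image fun I : Finset (Fin n) => formWt W D I).exists_le
  refine ⟨-B, fun s c hs I ν _ => ?_⟩
  have := hB _ (Finset.mem_image_of_mem _ (Finset.mem_univ I))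
  omega

/-- Raising the order of an element whose boundary has higher order. -/
theorem exists_comp_mem_formGE_succ (hJ : FiniteJacobian g) (hg : IsHomog W D g)
    (hfg : f - g ∈ orderGE W (D + 1)) {j : ℕ} (hj : j < n) {p r t : ℤ} (m : ℕ)
    (x : Finset (Fin n) → Micro n) (hx : HasDegree j x) (hp : ∀ q, p < q → comp x q = 0)
    (ht : ∀ q, r < q → comp x q ∈ formGE W D (t + q * D))
    (hd : ∀ q, r < q → comp (gmD f x) q ∈ formGE W D (t + 1 + q * D))
    (hm : ∀ q, r + m < q → comp x q ∈ formGE W D (t + 1 + q * D)) :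
    ∃ x', HasDegree j x' ∧ gmD f x' = gmD f x ∧ (∀ q, p < q → comp x' q = 0) ∧
      ∀ q, r < q → comp x' q ∈ formGE W D (t + 1 + q * D) := by
  induction m generalizing x with
  | zero => exact ⟨x, hx, rfl, hp, fun q hq => hm q (by simpa using hq)⟩
  | succ m ih =>
    push_cast at hm
    set q₀ := r + (m + 1) with hq₀
    -- Above level `p` the component is already zero; a correction there could destroy the bound on
    -- the levels.
    by_cases hpq : p < q₀
    · refine ih x hx hp ht hd fun q hq => ?_
      rw [hp q (by omega)]
      exact zero_mem _
    -- Level `q₀ + 1` already has the improved order, so its exterior derivative has the improved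
    -- order at level `q₀`. Together with `hd` this controls `df ∧` of the component.
    have h0 : wedgeD f (comp x q₀) ∈ formGE W D (t + q₀ * D + 1) := by
      have h1 := hd q₀ (by omega)
      have h2 := deRhamD_mem_formGE (hm (q₀ + 1) (by omega))
      rw [comp_gmD] at h1
      have h3 := sub_mem (formGE_anti (s := t + 1 + q₀ * D) (by linarith) h2) h1
      rw [sub_sub_cancel] at h3
      exact formGE_anti (by linarith) h3
    obtain ⟨b, hb, hb'⟩ := exists_sub_smulD_mem_orderGE hJ hg hfg
      (fun I hI => hx.comp q₀ I (by omega)) (ht q₀ (by omega)) h0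
    have hη : degreePart j b ∈ formGE W D (t + q₀ * D) := fun I => by
      rw [degreePart]
      split_ifs
      · exact hb I
      · exact Submodule.zero_mem _
    have hη' : comp x q₀ - wedgeD f (degreePart j b) ∈ formGE W D (t + q₀ * D + 1) := fun I => by
      rw [Pi.sub_apply]
      by_cases hI : I.card = j
      · rw [wedgeD_degreePart b hI]
        exact hb' I
      · rw [wedgeD_degreePart_of_ne b hI, hx.comp _ I hI, sub_zero]
        exact Submodule.zero_mem _
    obtain ⟨x', hx', hxd, hxp, hxr⟩ := ih (x + gmD f (inj q₀ (degreePart j b)))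
      (hx.add_gmD_inj _ fun I hI => if_neg hI)
      (fun q hq => by rw [comp_add_gmD_inj_of_ne _ _ _ (by omega) (by omega), hp q hq])
      (fun q hq => by
        rcases eq_or_ne q q₀ with rfl | hq1
        · rw [comp_add_gmD_inj]
          exact formGE_anti (by linarith) hη'
        rcases eq_or_ne q (q₀ - 1) with rfl | hq2
        · rw [comp_add_gmD_inj_sub_one]
          exact add_mem (ht _ hq) (formGE_anti (by linarith) (deRhamD_mem_formGE hη))
        · rw [comp_add_gmD_inj_of_ne _ _ _ hq1 hq2]
          exact ht q hq)
      (by rwa [map_add, gmD_gmD, add_zero])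
      (fun q hq => by
        rcases eq_or_ne q q₀ with rfl | hq1
        · rw [comp_add_gmD_inj]
          exact formGE_anti (by linarith) hη'
        · rw [comp_add_gmD_inj_of_ne _ _ _ hq1 (by omega)]
          exact hm q (by omega))
    exact ⟨x', hx', by rw [hxd, map_add, gmD_gmD, add_zero], hxp, hxr⟩

theorem exists_comp_mem_formGE (hJ : FiniteJacobian g) (hg : IsHomog W D g)
    (hfg : f - g ∈ orderGE W (D + 1)) {j : ℕ} (hj : j < n) {p r s : ℤ}
    (x : Finset (Fin n) → Micro n) (hx : HasDegree j x) (hp : ∀ q, p < q → comp x q = 0)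
    (hd : ∀ q, r < q → comp (gmD f x) q ∈ formGE W D (s + q * D)) :
    ∃ x', HasDegree j x' ∧ gmD f x' = gmD f x ∧ (∀ q, p < q → comp x' q = 0) ∧
      ∀ q, r < q → comp x' q ∈ formGE W D (s + q * D) := by
  have key : ∀ (k : ℕ) (t : ℤ), s ≤ t + k → ∀ x : Finset (Fin n) → Micro n, HasDegree j x →
      (∀ q, p < q → comp x q = 0) →
      (∀ q, r < q → comp (gmD f x) q ∈ formGE W D (s + q * D)) →
      (∀ q, r < q → comp x q ∈ formGE W D (t + q * D)) →
      ∃ x', HasDegree j x' ∧ gmD f x' = gmD f x ∧ (∀ q, p < q → comp x' q = 0) ∧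
        ∀ q, r < q → comp x' q ∈ formGE W D (s + q * D) := by
    intro k
    induction k with
    | zero =>
      intro t hst x hx hp _ ht
      exact ⟨x, hx, rfl, hp, fun q hq => formGE_anti (by push_cast at hst; linarith) (ht q hq)⟩
    | succ k ih =>
      intro t hst x hx hp hd ht
      rcases le_or_gt s t with h | h
      · exact ⟨x, hx, rfl, hp, fun q hq => formGE_anti (by linarith) (ht q hq)⟩
      obtain ⟨x₁, hx₁, hd₁, hp₁, ht₁⟩ := exists_comp_mem_formGE_succ hJ hg hfg hj (p - r).toNat x hx
        hp ht (fun q hq => formGE_anti (by linarith) (hd q hq)) (fun q hq => by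
          rw [hp q (by omega)]
          exact zero_mem _)
      obtain ⟨x₂, hx₂, hd₂, h₂⟩ := ih (t + 1) (by push_cast at hst; linarith) x₁ hx₁ hp₁
        (by rwa [hd₁]) ht₁
      exact ⟨x₂, hx₂, hd₂.trans hd₁, h₂⟩
  -- The start `t = B - p D` makes the condition automatic: it is empty at levels `q ≤ p`, and the
  -- components above `p` are zero. The order is then raised from `t` to `s` by unit steps.
  obtain ⟨B, hB⟩ := exists_forall_mem_formGE (n := n) (W := W) (D := D)
  refine key (s - (B - p * D)).toNat (B - p * D) (by omega) x hx hp hd fun q _ => ?_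
  rcases lt_or_ge p q with h | h
  · rw [hp q h]
    exact zero_mem _
  · refine hB _ _ ?_
    have : q * (D : ℤ) ≤ p * D := mul_le_mul_of_nonneg_right h (by positivity)
    linarith

theorem exists_forall_comp_eq_zero (x : Finset (Fin n) → Micro n) :
    ∃ p, ∀ q, p < q → comp x q = 0 := by
  obtain ⟨p, hp⟩ := (Finset.univ.biUnion fun I : Finset (Fin n) =>
    (x I).support.image fun i => i - (I.card : ℤ)).exists_le
  refine ⟨p, fun q hq => funext fun I => ?_⟩
  by_contra h
  have := hp q (Finset.mem_biUnion.2 ⟨I, Finset.mem_univ I, Finset.mem_image.2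
    ⟨q + I.card, Finsupp.mem_support_iff.2 h, by ring⟩⟩)
  omega

end

end GaussManin

/-! ### The filtrations in terms of levels, and the conclusion -/

namespace GaussManin

noncomputable section

variable {n : ℕ}

/-- Extension by zero to families indexed by all subsets. -/
def extendZero {m : ℤ} (ω : KoszulTerm n m) (I : Finset (Fin n)) : Micro n :=
  if h : (I.card : ℤ) = m + n then ω ⟨I, h⟩ else 0

/-- Restriction to one degree. -/
def toTerm (m : ℤ) (x : Finset (Fin n) → Micro n) : KoszulTerm n m := fun I => x I.1

theorem toTerm_extendZero {m : ℤ} (ω : KoszulTerm n m) : toTerm m (extendZero ω) = ω :=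
  funext fun I => dif_pos I.2

theorem koszulD_toTerm (f : ConvergentSeries n) {m m' : ℤ} (h : m + 1 = m')
    (x : Finset (Fin n) → Micro n) : koszulD f h (toTerm m x) = toTerm m' (gmD f x) := by
  ext1 I
  rw [koszulD_apply]
  exact Finset.sum_attach I.1 fun k => koszulSign I.1 k • microD f k (x (I.1.erase k))

theorem koszulD_extendZero (f : ConvergentSeries n) {m m' : ℤ} (h : m + 1 = m')
    (ω : KoszulTerm n m) : koszulD f h ω = toTerm m' (gmD f (extendZero ω)) := by
  rw [← koszulD_toTerm, toTerm_extendZero]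

theorem hasDegree_extendZero {m : ℤ} {j : ℕ} (hj : (j : ℤ) = m + n) (ω : KoszulTerm n m) :
    HasDegree j (extendZero ω) := fun I hI => dif_neg fun h => hI (by omega)

/-- Only exterior degrees `0 ≤ j < n` matter: below them the source is zero, and from `n` on the
target is zero. This is the range where the Koszul complex of `df` is exact. -/
theorem boundaryStrict_of_exists {f : ConvergentSeries n} {S : Bifiltered.Subcomplex (koszul f)}
    (H : ∀ (m : ℤ) (j : ℕ), (j : ℤ) = m + n → j < n → ∀ x : Finset (Fin n) → Micro n,
      HasDegree j x → toTerm (m + 1) (gmD f x) ∈ S.carrier (m + 1) →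
      ∃ x', toTerm m x' ∈ S.carrier m ∧ gmD f x' = gmD f x) : S.BoundaryStrict := by
  intro m m' x hx
  have zero : (koszul f).d m m' = 0 ∨ x = 0 → ∃ y ∈ S.carrier m,
      ((koszul f).d m m').hom y = ((koszul f).d m m').hom x := by
    rintro (h | rfl)
    · exact ⟨0, Submodule.zero_mem _, by rw [h]; rfl⟩
    · exact ⟨0, Submodule.zero_mem _, rfl⟩
  by_cases h : m + 1 = m'
  swap
  · exact zero (Or.inl (dif_neg h))
  subst h
  by_cases h1 : m + n < 0
  · refine zero (Or.inr (funext fun I => ?_))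
    have := I.2
    omega
  by_cases h2 : 0 ≤ m
  · refine zero (Or.inl ?_)
    ext x
    refine funext fun I => ?_
    have h3 := I.2
    have h4 := Finset.card_le_univ I.1
    rw [Fintype.card_fin] at h4
    omega
  have hd : ∀ y : KoszulTerm n m, ((koszul f).d m (m + 1)).hom y = koszulD f rfl y := fun y => by
    have e : (koszul f).d m (m + 1) = ModuleCat.ofHom (koszulD f rfl) := dif_pos rfl
    rw [e]
    rfl
  have hj : ((m + n).toNat : ℤ) = m + n := by omega
  have hx2 : toTerm (m + 1) (gmD f (extendZero x)) ∈ S.carrier (m + 1) :=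
    (congrArg (fun z => z ∈ S.carrier (m + 1)) ((hd x).trans (koszulD_extendZero f rfl x))).mp hx
  obtain ⟨x', hx', e⟩ := H m (m + n).toNat hj (by omega) _ (hasDegree_extendZero hj x) hx2
  refine ⟨toTerm m x', hx', (hd _).trans (Eq.trans ?_ (hd x).symm)⟩
  rw [koszulD_toTerm, e]
  exact (koszulD_extendZero f rfl x).symm

theorem toTerm_mem_koszulF {f : ConvergentSeries n} {p m : ℤ} {x : Finset (Fin n) → Micro n}
    (h : ∀ q, p - n < q → comp x q = 0) : toTerm m x ∈ (koszulF f p).carrier m := by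
  intro I _ i hi
  have h1 := congrFun (h (i - I.1.card) (by have := I.2; omega)) I.1
  rwa [comp, sub_add_cancel] at h1

theorem comp_eq_zero_of_mem_koszulF {f : ConvergentSeries n} {p m : ℤ} {j : ℕ}
    (hj : (j : ℤ) = m + n) {x : Finset (Fin n) → Micro n} (hx : HasDegree j x)
    (h : toTerm m x ∈ (koszulF f p).carrier m) {q : ℤ} (hq : p - n < q) : comp x q = 0 := by
  ext1 I
  by_cases hI : I.card = j
  · exact h ⟨I, by omega⟩ trivial (q + I.card) (by omega)
  · exact hx.comp q I hI

theorem HasDegree.gmD {f : ConvergentSeries n} {x : Finset (Fin n) → Micro n} {j : ℕ}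
    (hx : HasDegree j x) : HasDegree (j + 1) (gmD f x) :=
  fun _ hI => totalD_apply_of_card_ne hx hI

/-- Multiplication by `D` makes all weights integral, so the rational bound `α D` may be rounded up;
the two occurrences of `∑ w_i` cancel. -/
theorem mem_ringU_iff {w : Fin n → ℚ} {W : Fin n → ℕ} {D : ℕ} (hD : 0 < D)
    (hW : ∀ i, (W i : ℚ) = w i * D) (α : ℚ) (q : ℤ) (I : Finset (Fin n)) (a : ConvergentSeries n) :
    a ∈ ringU w (α + (∑ i, w i - ∑ k ∈ I, w k) + ((q + I.card : ℤ) : ℚ)) ↔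
      a ∈ orderGE W (⌈α * D⌉ + q * D + formWt W D I) := by
  refine forall_congr' fun ν => imp_congr Iff.rfl ?_
  have hD' : (0 : ℚ) < D := by exact_mod_cast hD
  have h1 : (wt W ν : ℚ) = (∑ i, w i * ν i) * D := by
    rw [wt, Finset.sum_mul]
    push_cast
    exact Finset.sum_congr rfl fun i _ => by rw [hW]; ring
  have h2 : (formWt W D I : ℚ) = (I.card - ∑ k ∈ I, w k) * D := by
    rw [formWt]
    push_cast
    rw [Finset.sum_sub_distrib, Finset.sum_const, nsmul_eq_mul, sub_mul, Finset.sum_mul]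
    congr 1
    exact Finset.sum_congr rfl fun k _ => hW k
  have h3 : ∑ i, w i * ((ν i : ℚ) + 1) = ∑ i, w i * ν i + ∑ i, w i := by
    rw [← Finset.sum_add_distrib]
    exact Finset.sum_congr rfl fun i _ => by ring
  have h4 : ⌈α * D⌉ + q * D + formWt W D I ≤ wt W ν ↔
      ⌈α * D⌉ ≤ (wt W ν : ℤ) - q * D - formWt W D I := by
    constructor <;> intro h <;> linarith
  rw [h4, Int.ceil_le, h3]
  push_cast
  rw [h1, h2, ← sub_nonneg, ← sub_nonneg (b := α * D)]
  have h5 : (∑ i, w i * (ν i : ℚ)) * D - q * D - (I.card - ∑ k ∈ I, w k) * D - α * D =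
      (∑ i, w i * (ν i : ℚ) + ∑ i, w i -
        (α + (∑ i, w i - ∑ k ∈ I, w k) + (q + I.card))) * D := by ring
  rw [h5, mul_nonneg_iff_of_pos_right hD']

section Membership

variable {w : Fin n → ℚ} {f : ConvergentSeries n} {W : Fin n → ℕ} {D : ℕ}

theorem toTerm_mem_koszulU (hf : IsSemiquasihomogeneous w f) (hD : 0 < D)
    (hW : ∀ i, (W i : ℚ) = w i * D) {α : ℚ} {m : ℤ} {x : Finset (Fin n) → Micro n}
    (h : ∀ q, comp x q ∈ formGE W D (⌈α * D⌉ + q * D)) :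
    toTerm m x ∈ (koszulU hf α).carrier m := by
  intro I _ i
  have h1 := (mem_ringU_iff hD hW α (i - I.1.card) I.1 _).2 (h (i - I.1.card) I.1)
  rwa [comp, sub_add_cancel] at h1

/-- Above level `p - n` the summand in `F_p` vanishes, so only the summand in `U^α` contributes. -/
theorem comp_mem_formGE_of_mem_sup (hf : IsSemiquasihomogeneous w f) (hD : 0 < D)
    (hW : ∀ i, (W i : ℚ) = w i * D) {α : ℚ} {p m : ℤ} {j : ℕ} (hj : (j : ℤ) = m + n)
    {x : Finset (Fin n) → Micro n} (hx : HasDegree j x)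
    (h : toTerm m x ∈ (koszulF f p ⊔ koszulU hf α).carrier m) {q : ℤ} (hq : p - n < q) :
    comp x q ∈ formGE W D (⌈α * D⌉ + q * D) := by
  intro I
  by_cases hI : I.card = j
  · obtain ⟨y, hy, z, hz, e⟩ := Bifiltered.Subcomplex.mem_sup_carrier.1 h
    have hI' : (I.card : ℤ) = m + n := by omega
    refine (mem_ringU_iff hD hW α q I _).1 ?_
    have h1 : x I = (y : KoszulTerm n m) ⟨I, hI'⟩ + (z : KoszulTerm n m) ⟨I, hI'⟩ :=
      (congrFun e ⟨I, hI'⟩).symm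
    have h2 : (y : KoszulTerm n m) ⟨I, hI'⟩ (q + I.card) = 0 :=
      hy ⟨I, hI'⟩ trivial (q + I.card) (by omega)
    rw [comp, h1, Finsupp.add_apply, h2, zero_add]
    exact hz ⟨I, hI'⟩ trivial (q + I.card)
  · rw [hx.comp q I hI]
    exact Submodule.zero_mem _

theorem comp_mem_formGE_of_mem_koszulU (hf : IsSemiquasihomogeneous w f) (hD : 0 < D)
    (hW : ∀ i, (W i : ℚ) = w i * D) {α : ℚ} {m : ℤ} {j : ℕ} (hj : (j : ℤ) = m + n)
    {x : Finset (Fin n) → Micro n} (hx : HasDegree j x)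
    (h : toTerm m x ∈ (koszulU hf α).carrier m) (q : ℤ) :
    comp x q ∈ formGE W D (⌈α * D⌉ + q * D) :=
  -- With this `p` the given level `q` is the first one above `p - n`.
  comp_mem_formGE_of_mem_sup hf hD hW (p := q + n - 1) hj hx 
    ((le_sup_right : koszulU hf α ≤ koszulF f (q + n - 1) ⊔ koszulU hf α) m h) (by omega)

/-- Cutting `x` at level `p - n` gives the decomposition: the lower levels lie in `F_p`, the upper
ones in `U^α`. -/
theorem toTerm_mem_sup (hf : IsSemiquasihomogeneous w f) (hD : 0 < D)
    (hW : ∀ i, (W i : ℚ) = w i * D) {α : ℚ} {p m : ℤ} {x : Finset (Fin n) → Micro n}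
    (h : ∀ q, p - n < q → comp x q ∈ formGE W D (⌈α * D⌉ + q * D)) :
    toTerm m x ∈ (koszulF f p ⊔ koszulU hf α).carrier m := by
  classical
  let y : Finset (Fin n) → Micro n := fun I => (x I).filter fun i => i ≤ p - n + I.card
  let z : Finset (Fin n) → Micro n := fun I => (x I).filter fun i => ¬ i ≤ p - n + I.card
  have hy : ∀ q, p - n < q → comp y q = 0 := fun q hq => funext fun I =>
    Finsupp.filter_apply_neg _ _ (by omega)
  have hz : ∀ q, comp z q ∈ formGE W D (⌈α * D⌉ + q * D) := fun q => by
    rcases lt_or_ge (p - n) q with hq | hq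
    · have e : comp z q = comp x q := funext fun I => Finsupp.filter_apply_pos _ _ (by omega)
      rw [e]
      exact h q hq
    · have e : comp z q = 0 := funext fun I => Finsupp.filter_apply_neg _ _ (by omega)
      rw [e]
      exact zero_mem _
  refine Bifiltered.Subcomplex.mem_sup_carrier.2 ⟨toTerm m y, toTerm_mem_koszulF hy, toTerm m z,
    toTerm_mem_koszulU hf hD hW hz, funext fun I => ?_⟩
  exact Finsupp.filter_add_filter_not _ _

end Membership

theorem exists_integral_weights {w : Fin n → ℚ} (hw : ∀ i, 0 < w i) :
    ∃ (D : ℕ) (W : Fin n → ℕ), 0 < D ∧ (∀ i, 0 < W i) ∧ ∀ i, (W i : ℚ) = w i * D := by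
  have h : ∀ i, ∃ e : ℕ, 0 < e ∧ ∏ j, (w j).den = (w i).den * e := fun i => by
    obtain ⟨e, he⟩ := Finset.dvd_prod_of_mem (fun j => (w j).den) (Finset.mem_univ i)
    refine ⟨e, Nat.pos_of_ne_zero fun h0 => ?_, he⟩
    rw [h0, mul_zero] at he
    exact (Finset.prod_pos fun j _ => (w j).den_pos).ne' he
  choose e he he' using h
  have hnum : ∀ i, 0 < (w i).num := fun i => Rat.num_pos.2 (hw i)
  refine ⟨∏ j, (w j).den, fun i => (w i).num.toNat * e i, Finset.prod_pos fun j _ => (w j).den_pos,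
    fun i => Nat.mul_pos (by have := hnum i; omega) (he i), fun i => ?_⟩
  have h1 : (((w i).num.toNat : ℕ) : ℚ) = (w i).num := by
    exact_mod_cast Int.toNat_of_nonneg (hnum i).le
  rw [he' i]
  push_cast
  rw [h1, ← mul_assoc, Rat.mul_den_eq_num]

theorem cast_wt_eq_weight_mul {w : Fin n → ℚ} {W : Fin n → ℕ} {D : ℕ}
    (hW : ∀ i, (W i : ℚ) = w i * D) (ν : Fin n →₀ ℕ) :
    (wt W ν : ℚ) = Finsupp.weight w ν * D := by
  rw [Finsupp.weight_apply, Finsupp.sum_fintype _ _ (by simp), wt, Finset.sum_mul]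
  push_cast
  refine Finset.sum_congr rfl fun i _ => ?_
  rw [hW, nsmul_eq_mul]
  ring

/-- A semiquasihomogeneous function is, for suitable integral weights, a perturbation by terms of
higher weight of a weighted homogeneous one whose Jacobian ideal has finite colength. -/
theorem IsSemiquasihomogeneous.exists_homog {w : Fin n → ℚ} {f : ConvergentSeries n}
    (hf : IsSemiquasihomogeneous w f) {W : Fin n → ℕ} {D : ℕ} (hD : 0 < D)
    (hW0 : ∀ i, 0 < W i) (hW : ∀ i, (W i : ℚ) = w i * D) :
    ∃ g, FiniteJacobian g ∧ IsHomog W D g ∧ f - g ∈ orderGE W (D + 1) := by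
  obtain ⟨f', f'', ⟨hq, hiso⟩, h'', hff⟩ := hf
  have hD' : (0 : ℚ) < D := by exact_mod_cast hD
  have hg : ∀ ν, MvPolynomial.coeff ν f' ≠ 0 → wt W ν = D := fun ν hν => by
    have h := cast_wt_eq_weight_mul hW ν
    rw [hq hν, one_mul] at h
    exact_mod_cast h
  refine ⟨ofPoly f', finiteJacobian_ofPoly hW0 hg hiso, fun ν hν => ?_, fun ν hν => ?_⟩
  · rw [coeffC_ofPoly] at hν
    exact_mod_cast hg ν hν
  · have e : f - ofPoly f' = f'' := by
      rw [sub_eq_iff_eq_add']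
      refine toSeries_injective ?_
      rw [map_add, toSeries_ofPoly, hff]
    rw [e] at hν
    have h1 : 1 < Finsupp.weight w ν := by
      by_contra! hle
      exact hν (h'' ν hle)
    have h2 : (D : ℚ) < wt W ν := by
      rw [cast_wt_eq_weight_mul hW ν]
      exact lt_mul_of_one_lt_left hD' h1
    have h3 : D < wt W ν := by exact_mod_cast h2
    omega

/-- The bifiltered complex `(K_f; F, U)` is strict. -/
theorem isStrict_bifilteredKoszul (hn : 0 < n) {w : Fin n → ℚ} (hw : ∀ i, 0 < w i)
    {f : ConvergentSeries n} (hf : IsSemiquasihomogeneous w f) : (bifilteredKoszul hf).IsStrict := by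
  obtain ⟨D, W, hD, hW0, hW⟩ := exists_integral_weights hw
  obtain ⟨g, hJg, hg, hfg⟩ := hf.exists_homog hD hW0 hW
  have hJf : FiniteJacobian f := hJg.of_isHomog hg hfg hn hW0
  intro p α
  obtain ⟨B, hB⟩ := exists_forall_mem_formGE (n := n) (W := W) (D := D)
  set s := ⌈α * D⌉ with hs
  -- At levels up to `r` membership in `U^α` is automatic, so only the finitely many levels between
  -- `r` and the top one need correction.
  obtain ⟨r, hr⟩ : ∃ r : ℤ, ∀ q ≤ r, s + q * D ≤ B := by
    refine ⟨-|s| - |B|, fun q hq => ?_⟩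
    have h1 := neg_abs_le B
    have h2 := le_abs_self s
    have h3 : q * (D : ℤ) ≤ q := by
      have : q ≤ 0 := by have := abs_nonneg s; have := abs_nonneg B; omega
      have h4 : (1 : ℤ) ≤ D := by exact_mod_cast hD
      nlinarith
    linarith
  have hfull : ∀ {x : Finset (Fin n) → Micro n},
      (∀ q, r < q → comp x q ∈ formGE W D (s + q * D)) →
      ∀ q, comp x q ∈ formGE W D (s + q * D) := fun h q => by
    rcases lt_or_ge r q with hq | hq
    · exact h q hq
    · exact hB _ _ (hr q hq)
  have hF : ∀ {m : ℤ} {j : ℕ}, (j : ℤ) = m + n → j < n → ∀ {x : Finset (Fin n) → Micro n},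
      HasDegree j x → toTerm (m + 1) (gmD f x) ∈ (koszulF f p).carrier (m + 1) →
      ∃ x', HasDegree j x' ∧ gmD f x' = gmD f x ∧ ∀ q, p - n < q → comp x' q = 0 := by
    intro m j hj hjn x hx h
    obtain ⟨b, hb⟩ := exists_forall_comp_eq_zero x
    exact exists_comp_eq_zero hJf hjn (b - (p - n)).toNat x hx (fun q hq => hb q (by omega))
      fun q hq => comp_eq_zero_of_mem_koszulF (j := j + 1) (by push_cast; omega) hx.gmD h hq
  refine Bifiltered.Subcomplex.StrictPair.of_boundaryStrict
    (boundaryStrict_of_exists fun m j hj hjn x hx h => ?_)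
    (boundaryStrict_of_exists fun m j hj hjn x hx h => ?_)
    (boundaryStrict_of_exists fun m j hj hjn x hx h => ?_)
    (boundaryStrict_of_exists fun m j hj hjn x hx h => ?_)
  · obtain ⟨x', -, hd, hx'⟩ := hF hj hjn hx h
    exact ⟨x', toTerm_mem_koszulF hx', hd⟩
  · obtain ⟨b, hb⟩ := exists_forall_comp_eq_zero x
    obtain ⟨x', -, hd, -, hx'⟩ := exists_comp_mem_formGE hJg hg hfg hjn (r := r) (s := s) x hx hb
      fun q _ => comp_mem_formGE_of_mem_koszulU hf hD hW (j := j + 1) (by push_cast; omega)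
        hx.gmD h q
    exact ⟨x', toTerm_mem_koszulU hf hD hW (hfull hx'), hd⟩
  -- For the intersection the levels are bounded first; raising the order afterwards preserves that
  -- bound.
  · obtain ⟨x₁, hx₁, hd₁, hp₁⟩ := hF hj hjn hx h.1
    obtain ⟨x', -, hd, hp', hx'⟩ := exists_comp_mem_formGE hJg hg hfg hjn (r := r) (s := s) x₁ hx₁ hp₁
      fun q _ => by
        rw [hd₁]
        exact comp_mem_formGE_of_mem_koszulU hf hD hW (j := j + 1) (by push_cast; omega)
          hx.gmD h.2 q
    exact ⟨x', ⟨toTerm_mem_koszulF hp', toTerm_mem_koszulU hf hD hW (hfull hx')⟩, hd.trans hd₁⟩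
  -- For the sum the order is raised only above level `p - n`, since lower levels are unrestricted;
  -- hence `r = p - n`.
  · obtain ⟨b, hb⟩ := exists_forall_comp_eq_zero x
    obtain ⟨x', -, hd, -, hx'⟩ := exists_comp_mem_formGE hJg hg hfg hjn (r := p - n) (s := s) x hx hb
      fun q hq => comp_mem_formGE_of_mem_sup hf hD hW (j := j + 1) (by push_cast; omega)
        hx.gmD h hq
    exact ⟨x', toTerm_mem_sup hf hD hW hx', hd⟩

end

end GaussManin

theorem proposition5p2 (n : ℕ) (hn : 1 < n) (w : Fin n → ℚ)
    (hw : ∀ i, 0 < w i ∧ w i ≤ 1 / 2) (f : GaussManin.ConvergentSeries n)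
    (hf : GaussManin.IsSemiquasihomogeneous w f) :
    (GaussManin.bifilteredKoszul hf).IsStrict :=
  GaussManin.isStrict_bifilteredKoszul (by omega) (fun i => (hw i).1) hf
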